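/- **Maximal stability of threshold-based backpressure (BP-T).** *Network.* A finite physical network has directed links of positive integer capacities (packets per slot), and its nodes are partitioned into routers $\mathcal V$ and forwarders. An overlay on it consists of a set $\mathcal E$ of tunnels $(i,j)$ with $i\neq j$ routers. Each tunnel is a fixed acyclic path from $i$ to $j$ with $M_{ij}\ge 1$ intermediate nodes, all of them forwarders. Let $R^{\rm in}_{ij}$ be the capacity of the first link of the tunnel, and $R^{\min}_{ij},R^{\max}_{ij}$ the smallest and greatest capacity of its links. The tunnels are *non-overlapping*: no physical link belongs to two different tunnels, first links being disregarded. $\mathcal C$ is a finite set of sessions; session $c$ has a destination router $d_c$, which every router can reach through a chain of tunnels. *Dynamics.* Time is slotted, and the system starts empty. In slot $t$ a control policy $\pi$ (possibly randomized, using the past and the current backlogs) chooses numbers $\mu_{ij}^c(t)\in\mathbb N$ of session-$c$ packets to be routed into tunnel $(i,j)$. It is *permissible*, $\pi\in\Pi$, if always $\sum_c\mu^c_{ij}(t)\le R^{\rm in}_{ij}$. The router backlogs satisfy $Q_{d_c}^c=0$ and, for $i\ne d_c$, $$Q_i^c(t+1)=\Big(Q_i^c(t)-\sum_{b:(i,b)\in\mathcal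 E}\mu_{ib}^c(t)\Big)^+ +\sum_{a:(a,i)\in\mathcal E}\phi_{ai}^c(t)+A_i^c(t),$$ where $\phi_{ai}^c(t)$ is the number of session-$c$ packets that exit tunnel $(a,i)$ in slot $t$. At most $\mu_{ij}^c(t)$ packets of session $c$ enter tunnel $(i,j)$ in slot $t$; these include all packets that leave the router queue, and may include dummy packets, which are treated like other packets. Within a tunnel, packets are passed on from forwarder to forwarder, one link per slot. The forwarders use an arbitrary work-conserving scheduling (possibly randomized, using the past and the current backlogs): each link out of a forwarder carries, in every slot, the minimum of its capacity and the number of packets waiting for it. $F_{ij}(t)$ is the number of packets in tunnel $(i,j)$. The arrivals $A_i^c(t)\in\{0,\dots,A_{\max}\}$ are i.i.d. over slots, independent across routers and sessions and of the randomization of the policy and of the forwarders, with mean $\lambda_i^c$ (where $\lambda_{d_c}^c=0$); for each $\lambda$ a distribution of the arrivals with this mean is fixed. *Stability.* A queue $X(t)$ is stable if $\limsup_{T\to\infty}\frac1T\sum_{t=0}^{T-1}\mathbb E[X(t)]<\infty$, and the network is stable if all $Q_i^c$ and $F_{ij}$ are. $\Lambda^\pi(\mathcal V)$ is the closure of the set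 of $\lambda$ for which the network is stable under $\pi$, and $\Lambda(\mathcal V)$ is the closure of the set of $\lambda$ for which it is stable under some $\pi\in\Pi$. *BP-T.* Put $T_0=\max_{(i,j)\in\mathcal E}\big[M_{ij}R^{\min}_{ij}+\tfrac{M_{ij}(M_{ij}-1)}2R^{\max}_{ij}\big]$ and $T=T_0+\max_{(i,j)\in\mathcal E}R^{\rm in}_{ij}$. For each slot and tunnel $(i,j)$, BP-T picks $c^*\in\arg\max_c\,(Q_i^c(t)-Q_j^c(t))$, ties resolved arbitrarily. It sets $\mu_{ij}^{c^*}(t)=R^{\rm in}_{ij}$ if $Q_i^{c^*}(t)>Q_j^{c^*}(t)$ and $F_{ij}(t)\le T$, and $\mu_{ij}^{c^*}(t)=0$ otherwise; $\mu_{ij}^c(t)=0$ for $c\ne c^*$. Missing packets are replaced by dummy packets, so that exactly $\mu_{ij}^c(t)$ packets enter. **Theorem.** BP-T is maximally stable: $$\Lambda^{\text{BP-T}}(\mathcal V)\supseteq\Lambda^{\pi}(\mathcal V)\quad\text{for all }\pi\in\Pi .$$ Moreover, the network is stable under BP-T for every arrival-rate vector $\lambda$ for which some $\lambda'\in\Lambda(\mathcal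 V)$ satisfies $\lambda_i^c<\lambda_i'^{\,c}$ for all $c\in\mathcal C$ and $i\neq d_c$. -/

import Mathlib

open MeasureTheory Filter
open scoped ENNReal

noncomputable section

/-- A physical network whose nodes are partitioned into routers `V` and forwarders `W`, together
with its overlay: the tunnels `E` (fixed acyclic paths from a router to a router through
forwarders only) and the sessions `C`, each with its destination router. -/
structure OverlayNetwork (V W E C : Type*) where
  /-- Capacity of the physical link between two nodes, in packets per slot (`0` means no link). -/
  cap : V ⊕ W → V ⊕ W → ℕ
  /-- First node of the path of a tunnel. -/
  src : E → V
  /-- Last node of the path of a tunnel. -/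
  dst : E → V
  /-- Number of forwarders on the path of a tunnel. -/
  numFwd : E → ℕ
  /-- The forwarders on the path of a tunnel, in the order in which packets visit them. -/
  fwd : (e : E) → Fin (numFwd e) → W
  /-- Destination router of a session. -/
  dest : C → V
  src_ne_dst : ∀ e, src e ≠ dst e
  /-- A tunnel is determined by its pair of end-points (one path per pair of routers). -/
  tunnel_ext : ∀ e e', src e = src e' → dst e = dst e' → e = e'
  numFwd_pos : ∀ e, 0 < numFwd e
  /-- The paths are acyclic. -/
  fwd_injective : ∀ e, Function.Injective (fwd e)
  /-- The first link of a tunnel, from its source router to its first forwarder, exists. -/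
  cap_first_pos : ∀ e, 0 < cap (Sum.inl (src e)) (Sum.inr (fwd e ⟨0, numFwd_pos e⟩))
  /-- The link from one forwarder of a tunnel to the next one exists. -/
  cap_mid_pos : ∀ e (k : ℕ) (hk : k + 1 < numFwd e),
    0 < cap (Sum.inr (fwd e ⟨k, Nat.lt_of_succ_lt hk⟩)) (Sum.inr (fwd e ⟨k + 1, hk⟩))
  /-- The last link of a tunnel, from its last forwarder to its end router, exists. -/
  cap_last_pos : ∀ e, 0 < cap
    (Sum.inr (fwd e ⟨numFwd e - 1, Nat.sub_lt (numFwd_pos e) Nat.one_pos⟩)) (Sum.inl (dst e))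

namespace OverlayNetwork

variable {V W E C : Type*}

/-! ### Topology -/

/-- The `k`-th node on the path of tunnel `e`: the source router is node `0`, the forwarders are
nodes `1, …, numFwd e`, and the end router is node `numFwd e + 1`. -/
def node (N : OverlayNetwork V W E C) (e : E) (k : ℕ) : V ⊕ W :=
  if k = 0 then Sum.inl (N.src e)
  else if h : k - 1 < N.numFwd e then Sum.inr (N.fwd e ⟨k - 1, h⟩)
  else Sum.inl (N.dst e)

/-- The physical link that leaves the `k`-th node of tunnel `e` (for `k ≤ numFwd e`). -/
def link (N : OverlayNetwork V W E C) (e : E) (k : ℕ) : (V ⊕ W) × (V ⊕ W) :=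
  (N.node e k, N.node e (k + 1))

/-- Capacity of the physical link that leaves the `k`-th node of tunnel `e`. -/
def linkCap (N : OverlayNetwork V W E C) (e : E) (k : ℕ) : ℕ :=
  N.cap (N.link e k).1 (N.link e k).2

/-- All physical links of a tunnel with the exception of its first (input) link. -/
def innerLinks (N : OverlayNetwork V W E C) (e : E) : Set ((V ⊕ W) × (V ⊕ W)) :=
  {l | ∃ k, 1 ≤ k ∧ k ≤ N.numFwd e ∧ N.link e k = l}

/-- The non-overlapping tunnels condition. -/
def NonOverlapping (N : OverlayNetwork V W E C) : Prop :=
  ∀ e₁ e₂, e₁ ≠ e₂ → N.innerLinks e₁ ∩ N.innerLinks e₂ = ∅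

/-- Every router can reach the destination of every session by a chain of tunnels. -/
def DestReachable (N : OverlayNetwork V W E C) : Prop :=
  ∀ (i : V) (c : C), Relation.ReflTransGen (fun u v => ∃ e, N.src e = u ∧ N.dst e = v) i (N.dest c)

/-- Capacity `Rⁱⁿ` of the input link of a tunnel. -/
def Rin (N : OverlayNetwork V W E C) (e : E) : ℕ := N.linkCap e 0

/-- Smallest capacity `Rᵐⁱⁿ` (bottleneck) among the physical links of a tunnel. -/
def Rmin (N : OverlayNetwork V W E C) (e : E) : ℕ :=
  (Finset.range (N.numFwd e + 1)).inf' Finset.nonempty_range_add_one (N.linkCap e)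

/-- Greatest capacity `Rᵐᵃˣ` among the physical links of a tunnel. -/
def Rmax (N : OverlayNetwork V W E C) (e : E) : ℕ :=
  (Finset.range (N.numFwd e + 1)).sup' Finset.nonempty_range_add_one (N.linkCap e)

/-- `T₀ = max over tunnels of  M Rᵐⁱⁿ + (M (M - 1) / 2) Rᵐᵃˣ`, with `M` the number of forwarders. -/
def T0 [Fintype E] (N : OverlayNetwork V W E C) : ℕ :=
  Finset.univ.sup fun e =>
    N.numFwd e * N.Rmin e + N.numFwd e * (N.numFwd e - 1) / 2 * N.Rmax e

/-- The threshold `T = T₀ + max over tunnels of Rⁱⁿ`. -/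
def threshold [Fintype E] (N : OverlayNetwork V W E C) : ℕ :=
  N.T0 + Finset.univ.sup N.Rin

/-! ### Queues, decisions and the one-slot dynamics -/

/-- The backlogs at the beginning of a slot. -/
structure State (N : OverlayNetwork V W E C) where
  /-- Router queues: `Q i c` is the number of session `c` packets at router `i`. -/
  Q : V → C → ℕ
  /-- `X e k c` is the number of session `c` packets of tunnel `e` that wait at the forwarder
  `fwd e k`. -/
  X : (e : E) → Fin (N.numFwd e) → C → ℕ

/-- The tunnel queue `F`: the number of packets in flight on a tunnel. -/
def State.F [Fintype C] {N : OverlayNetwork V W E C} (s : State N) (e : E) : ℕ :=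
  ∑ k, ∑ c, s.X e k c

/-- A routing decision for one slot. -/
structure Decision (E C : Type*) where
  /-- The routing function: number of session `c` packets to be routed into tunnel `e`. -/
  mu : E → C → ℕ
  /-- The number of session `c` packets that actually enter tunnel `e`. -/
  inj : E → C → ℕ

/-- The number of packets that each forwarder of each tunnel sends on in one slot,
per session. -/
abbrev Service (N : OverlayNetwork V W E C) := (e : E) → Fin (N.numFwd e) → C → ℕ

/-- Packets that exit a tunnel: those sent on by its last forwarder. -/
def output (N : OverlayNetwork V W E C) (φ : Service N) (e : E) (c : C) : ℕ :=
  φ e ⟨N.numFwd e - 1, Nat.sub_lt (N.numFwd_pos e) Nat.one_pos⟩ c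

/-- Number of session `c` packets that router `i` is to route into its tunnels. -/
def routedOut [Fintype E] [DecidableEq V] (N : OverlayNetwork V W E C) (m : E → C → ℕ)
    (i : V) (c : C) : ℕ :=
  ∑ e with N.src e = i, m e c

/-- Evolution of the backlogs over one slot, with decision `d`, forwarder service `φ` and exogenous
arrivals `a`. Packets that reach their destination leave the system. The truncated subtraction
of natural numbers is the positive part. -/
def next [Fintype E] [DecidableEq V] (N : OverlayNetwork V W E C) (s : State N)
    (d : Decision E C) (φ : Service N) (a : V → C → ℕ) : State N where
  Q i c := if i = N.dest c then 0
    else (s.Q i c - N.routedOut d.mu i c) + ∑ e with N.dst e = i, N.output φ e c + a i c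
  X e k c := s.X e k c - φ e k c +
    (if (k : ℕ) = 0 then d.inj e c else φ e ⟨k - 1, lt_of_le_of_lt (Nat.sub_le _ _) k.2⟩ c)

/-- Everything that happened in one slot. -/
structure Record (N : OverlayNetwork V W E C) where
  state : State N
  decision : Decision E C
  service : Service N
  arrivals : V → C → ℕ

/-- The past of the system: the records of all earlier slots, the latest first. Its length is the
index of the current slot. -/
abbrev History (N : OverlayNetwork V W E C) := List (Record N)

/-! ### Forwarder scheduling and control policies -/

/-- A rule by which the forwarders choose which waiting packets to send on, from the past, the
current backlogs and possibly a random seed. -/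
structure Scheduling (N : OverlayNetwork V W E C) where
  Seed : Type
  [seedSpace : MeasurableSpace Seed]
  seedLaw : Measure Seed
  [seedProb : IsProbabilityMeasure seedLaw]
  serve : Seed → History N → State N → Service N
  measurable_serve : ∀ h s e k, Measurable fun w => serve w h s e k
  /-- Only packets that are present can be sent. -/
  serve_le : ∀ w h s e k c, serve w h s e k c ≤ s.X e k c

attribute [instance] Scheduling.seedSpace Scheduling.seedProb

/-- Total, over all tunnels that use the physical link `l` beyond their input link, of the
quantity `x` attached to the forwarder of the tunnel that sends on `l`. -/
def linkTotal [Fintype E] [Fintype C] [DecidableEq V] [DecidableEq W]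
    (N : OverlayNetwork V W E C) (x : (e : E) → Fin (N.numFwd e) → C → ℕ)
    (l : (V ⊕ W) × (V ⊕ W)) : ℕ :=
  ∑ e, ∑ k : Fin (N.numFwd e), if N.link e (k + 1) = l then ∑ c, x e k c else 0

/-- A scheduling is work-conserving if every physical link out of a forwarder carries as many of
the packets waiting for it as its capacity permits. -/
def Scheduling.WorkConserving [Fintype E] [Fintype C] [DecidableEq V] [DecidableEq W]
    {N : OverlayNetwork V W E C} (σ : Scheduling N) : Prop :=
  ∀ w h s l, N.linkTotal (σ.serve w h s) l = min (N.cap l.1 l.2) (N.linkTotal s.X l)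

/-- A control policy: in every slot it makes a routing decision from the past, the current backlogs
and possibly a random seed. -/
structure Policy [Fintype E] [DecidableEq V] (N : OverlayNetwork V W E C) where
  Seed : Type
  [seedSpace : MeasurableSpace Seed]
  seedLaw : Measure Seed
  [seedProb : IsProbabilityMeasure seedLaw]
  decide : Seed → History N → State N → Decision E C
  measurable_mu : ∀ h s, Measurable fun w => (decide w h s).mu
  measurable_inj : ∀ h s, Measurable fun w => (decide w h s).inj
  /-- The packets that actually enter a tunnel might be fewer than the routing function says. -/
  inj_le_mu : ∀ w h s e c, (decide w h s).inj e c ≤ (decide w h s).mu e c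
  /-- All packets that leave a router queue enter the tunnels of that router (what else enters
  them is dummy packets). -/
  departures_le_inj : ∀ w h s i c,
    min (s.Q i c) (N.routedOut (decide w h s).mu i c) ≤ N.routedOut (decide w h s).inj i c

attribute [instance] Policy.seedSpace Policy.seedProb

section Policies

variable [Fintype E] [Fintype C] [DecidableEq V] {N : OverlayNetwork V W E C}

/-- The class `Π` of permissible policies: the routing functions obey the capacity of the input
link of every tunnel in every slot. -/
def Policy.Permissible (π : Policy N) : Prop :=
  ∀ w h s e, ∑ c, (π.decide w h s).mu e c ≤ N.Rin e

/-- `π` is a Threshold-based Backpressure policy BP-T (with some way of resolving ties): into each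
tunnel `e = (i, j)` it routes `Rⁱⁿ` packets of a session `c'` that maximizes `Q i c - Q j c`
if `Q i c' > Q j c'` and the tunnel backlog is at most the threshold, and nothing otherwise;
missing packets are filled with dummy packets. -/
def Policy.IsBPT [DecidableEq C] (π : Policy N) : Prop :=
  ∀ w h s e, ∃ c' : C,
    (∀ c, (s.Q (N.src e) c : ℤ) - s.Q (N.dst e) c ≤ s.Q (N.src e) c' - s.Q (N.dst e) c') ∧
    (∀ c, (π.decide w h s).mu e c =
      if c = c' ∧ s.Q (N.dst e) c' < s.Q (N.src e) c' ∧ s.F e ≤ N.threshold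
      then N.Rin e else 0) ∧
    (∀ c, (π.decide w h s).inj e c = (π.decide w h s).mu e c)

/-- The past and the current backlogs at slot `t`, for the arrivals `a` and the seeds `w` of the
policy and `u` of the forwarders. The system starts empty. -/
def traj (σ : Scheduling N) (π : Policy N) (a : ℕ × V × C → ℕ) (w : π.Seed) (u : σ.Seed) :
    ℕ → History N × State N
  | 0 => ([], ⟨fun _ _ => 0, fun _ _ _ => 0⟩)
  | t + 1 =>
    let h := (traj σ π a w u t).1
    let s := (traj σ π a w u t).2
    let d := π.decide w h s
    let φ := σ.serve u h s
    let arr := fun i c => a (t, i, c)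
    (⟨s, d, φ, arr⟩ :: h, N.next s d φ arr)

end Policies

/-! ### Arrivals, stability and throughput regions -/

/-- The arrival rates that arrivals bounded by `Amax` can have; a session has no arrivals at its own
destination. -/
def Admissible (N : OverlayNetwork V W E C) (Amax : ℕ) (r : V → C → ℝ) : Prop :=
  ∀ i c, 0 ≤ r i c ∧ r i c ≤ Amax ∧ (i = N.dest c → r i c = 0)

/-- For every rate vector `r`, the law of the number of session `c` packets that arrive at router
`i` in one slot: it is bounded by `Amax` and has mean `r i c`. -/
structure ArrivalModel (N : OverlayNetwork V W E C) (Amax : ℕ) where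
  law : (V → C → ℝ) → V → C → PMF ℕ
  bounded : ∀ r i c, ∀ n ∈ (law r i c).support, n ≤ Amax
  mean : ∀ r, N.Admissible Amax r → ∀ i c, ∫ n, (n : ℝ) ∂(law r i c).toMeasure = r i c

/-- Stability of a queue with random backlog `x t` in slot `t`: the limsup of the time averages
of the expected backlogs is finite. -/
def QueueStable {Ω : Type*} [MeasurableSpace Ω] (P : Measure Ω) (x : ℕ → Ω → ℕ) : Prop :=
  limsup (fun T : ℕ => (∑ t ∈ Finset.range T, ∫⁻ ω, (x t ω : ℝ≥0∞) ∂P) / (T : ℝ≥0∞)) atTop < ⊤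

section Regions

variable [Fintype E] [Fintype C] [DecidableEq V] {N : OverlayNetwork V W E C} {Amax : ℕ}

/-- The law of the whole system: the arrivals are independent over slots, routers and sessions, with
the same law in all slots, and independent of the seeds of the policy and of the forwarders. -/
def systemLaw (A : ArrivalModel N Amax) (σ : Scheduling N) (π : Policy N) (r : V → C → ℝ) :
    Measure ((ℕ × V × C → ℕ) × π.Seed × σ.Seed) :=
  (Measure.infinitePi fun x : ℕ × V × C => (A.law r x.2.1 x.2.2).toMeasure).prod
    (π.seedLaw.prod σ.seedLaw)

/-- The overlay network is stable under policy `π` for the arrival rates `r`: all router queues and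
all tunnel queues are stable. -/
def Stable (A : ArrivalModel N Amax) (σ : Scheduling N) (π : Policy N) (r : V → C → ℝ) : Prop :=
  (∀ i c, QueueStable (systemLaw A σ π r) fun t ω => (traj σ π ω.1 ω.2.1 ω.2.2 t).2.Q i c) ∧
  (∀ e, QueueStable (systemLaw A σ π r) fun t ω => (traj σ π ω.1 ω.2.1 ω.2.2 t).2.F e)

/-- The throughput region `Λ^π` of a policy: the closure of the set of arrival rates for which the
overlay network is stable under `π`. -/
def policyRegion (A : ArrivalModel N Amax) (σ : Scheduling N) (π : Policy N) :
    Set (V → C → ℝ) :=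
  closure {r | N.Admissible Amax r ∧ Stable A σ π r}

/-- The throughput region `Λ` of the class of permissible policies: the closure of the set of
arrival rates for which some permissible policy makes the overlay network stable. -/
def throughputRegion (A : ArrivalModel N Amax) (σ : Scheduling N) : Set (V → C → ℝ) :=
  closure {r | N.Admissible Amax r ∧ ∃ π : Policy N, π.Permissible ∧ Stable A σ π r}

end Regions

end OverlayNetwork

end

/-! Both halves rest on a comparison with flows: nonnegative rates `f e c` on the tunnels whose sum
over the sessions is at most the bottleneck `Rmin e` on every tunnel. A rate vector is served by `f`
with slack or deficit according to how the net outflow of `f` at each router other than the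
destination compares with the arrival rate.

Necessity (`Policy.Permissible.exists_flow_of_stable`). If a permissible policy stabilizes `r`, the
expected tunnel outputs, averaged over a well-chosen horizon, form such a flow, and it serves `r` up
to any prescribed deficit. The bottleneck limits the outputs; the packets left in the network at the
horizon account for the deficit.

Sufficiency (`Policy.IsBPT.stable_of_flow`). If a flow serves `r` with slack, BP-T is stable. Its
tunnels are bounded, because injection stops above the threshold. For the router queues the
quadratic Lyapunov function has negative drift over a window of `K` slots, `K` large. The crux is
that BP-T never starves a bottleneck: since tunnels do not overlap, each is a work-conserving
tandem, and the threshold is at least `(M + 1) * Rmin`. Hence, while some differential backlog stays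
positive, a tunnel takes in about `Rmin` packets per slot, up to a constant (`tandem_throughput`).
These packets belong to sessions of nearly maximal differential backlog, so that over the window
BP-T does as well as any flow, with a loss per unit of backlog that does not grow with `K`
(`backpressure_comparison`, `IsRun.drift`). The gain from the slack is `K * ε` per unit of backlog
and wins.

All of this is done on sample paths (`IsRun`). Probability enters through the independence of the
current backlogs from later arrivals, and through expectations of the path inequalities.
Reachability of the destinations supplies a flow with positive net outflow everywhere off the
destination, which turns a small deficit into slack for slightly scaled-down rates. -/

noncomputable section

/-! ### Tandem queues

`x t k` is the content of the `k`-th queue of a tandem at time `t`, and `y t k` is what enters this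
queue in slot `t`, so that `y t (k + 1)` is what leaves it. -/

section Tandem

variable {x y : ℕ → ℕ → ℕ} {M : ℕ}

lemma tandem_balance (hstep : ∀ t, ∀ k < M, x (t + 1) k + y t (k + 1) = x t k + y t k)
    (t n : ℕ) {k : ℕ} (hk : k ≤ M) :
    ∑ j ∈ Finset.Ico k M, x (t + n) j + ∑ i ∈ Finset.range n, y (t + i) M =
      ∑ j ∈ Finset.Ico k M, x t j + ∑ i ∈ Finset.range n, y (t + i) k := by
  have one : ∀ t, ∑ j ∈ Finset.Ico k M, x (t + 1) j + y t M =
      ∑ j ∈ Finset.Ico k M, x t j + y t k := by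
    intro t
    clear n
    induction M, hk using Nat.le_induction with
    | base => simp
    | succ m hm ih =>
      have h1 := ih (fun t j hj => hstep t j (by omega))
      have h2 := hstep t m (by omega)
      rw [Finset.sum_Ico_succ_top hm, Finset.sum_Ico_succ_top hm]
      omega
  induction n with
  | zero => simp
  | succ n ih =>
    have h := one (t + n)
    rw [Finset.sum_range_succ, Finset.sum_range_succ, ← add_assoc t n 1]
    omega

/-- Induction on time. A delay of one slot per queue costs at most `R`, hence the allowance `k * R`
at link `k`. When the input is blocked, `D i 0` is ahead of `D i M` by `T`; this covers the
allowance `M * R` at the exit and the `R` due in the current slot, which is why `(M + 1) * R` is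
needed. -/
lemma min_plus_lower_bound {D : ℕ → ℕ → ℕ} {R T n : ℕ} (hT : (M + 1) * R ≤ T)
    (h0 : ∀ i < n, D i 0 + R ≤ D (i + 1) 0 ∨ D i M + T ≤ D (i + 1) 0)
    (hD : ∀ i < n, ∀ k < M, D i (k + 1) + R ≤ D (i + 1) (k + 1) ∨ D i k ≤ D (i + 1) (k + 1)) :
    ∀ k ≤ M, R * n ≤ D n k + k * R := by
  induction n with
  | zero => simp
  | succ n ih =>
    have ih := ih (fun i hi => h0 i (by omega)) (fun i hi => hD i (by omega))
    intro k hk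
    rcases k with _ | k
    · have h1 := ih 0 (by omega)
      have h2 := ih M le_rfl
      rcases h0 n (by omega) with h | h
      · nlinarith
      · nlinarith
    · have h1 := ih (k + 1) hk
      have h2 := ih k (by omega)
      rcases hD n (by omega) k (by omega) with h | h
      · nlinarith
      · nlinarith

/-- Blocking the input does no harm as long as it happens only while the tandem holds `T` packets:
such a content keeps the slowest server supplied, so the long-run intake is still at least `R` per
slot. -/
lemma tandem_throughput {cap : ℕ → ℕ} {R T : ℕ} (hT : (M + 1) * R ≤ T)
    (hstep : ∀ t, ∀ k < M, x (t + 1) k + y t (k + 1) = x t k + y t k)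
    (hserve : ∀ t, ∀ k < M, y t (k + 1) = min (cap k) (x t k))
    (hcap : ∀ k < M, R ≤ cap k) (t n : ℕ)
    (hin : ∀ i < n, R ≤ y (t + i) 0 ∨ T ≤ ∑ j ∈ Finset.range M, x (t + i) j) :
    R * n ≤ ∑ i ∈ Finset.range n, y (t + i) 0 + ∑ j ∈ Finset.range M, x t j := by
  -- `D n k` counts the packets that have crossed link `k` during `n` slots or were beyond it at the
  -- start. Thus `D n k - D n M` is the content of the queues from `k` on at time `t + n`.
  set D : ℕ → ℕ → ℕ := fun n k =>
    ∑ i ∈ Finset.range n, y (t + i) k + ∑ j ∈ Finset.Ico k M, x t j with hDdef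
  have hsucc : ∀ n k, D (n + 1) k = D n k + y (t + n) k := by
    intro n k
    simp only [hDdef, Finset.sum_range_succ]
    ring
  have hbal : ∀ n, ∀ k ≤ M, D n k = D n M + ∑ j ∈ Finset.Ico k M, x (t + n) j := by
    intro n k hk
    have := tandem_balance hstep t n hk
    simp only [hDdef, Finset.Ico_self, Finset.sum_empty]
    omega
  have key := min_plus_lower_bound (D := D) (n := n) hT
    (by
      intro i hi
      rw [hsucc]
      rcases hin i hi with h | h
      · left; omega
      · right
        have := hbal i 0 (Nat.zero_le _)
        rw [← Finset.range_eq_Ico] at this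
        omega)
    (by
      intro i hi k hk
      rw [hsucc, hserve _ _ hk]
      have h1 := hbal i k hk.le
      have h2 := hbal i (k + 1) hk
      rw [Finset.sum_eq_sum_Ico_succ_bot hk] at h1
      have := hcap k hk
      -- Either the server is saturated, or it empties its queue and `D` at link `k + 1` catches up
      -- with the previous value at link `k`.
      rcases le_total (cap k) (x (t + i) k) with h | h
      · left; rw [min_eq_left h]; omega
      · right; rw [min_eq_right h]; omega) 0 (Nat.zero_le _)
  simpa only [hDdef, zero_mul, add_zero, ← Finset.range_eq_Ico] using key

end Tandem

namespace OverlayNetwork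

variable {V W E C : Type*}

/-! ### Links of a tunnel -/

section Links

variable (N : OverlayNetwork V W E C)

lemma node_zero (e : E) : N.node e 0 = Sum.inl (N.src e) := by simp [node]

lemma node_succ {e : E} {k : ℕ} (hk : k < N.numFwd e) :
    N.node e (k + 1) = Sum.inr (N.fwd e ⟨k, hk⟩) := by
  simp [node, hk]

lemma node_last (e : E) : N.node e (N.numFwd e + 1) = Sum.inl (N.dst e) := by
  simp [node]

lemma linkCap_pos {e : E} {k : ℕ} (hk : k ≤ N.numFwd e) : 0 < N.linkCap e k := by
  have hM := N.numFwd_pos e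
  rcases k with _ | k
  · simpa [linkCap, link, node_zero, node_succ N hM] using N.cap_first_pos e
  · rcases Nat.lt_or_ge (k + 1) (N.numFwd e) with h | h
    · simpa [linkCap, link, node_succ N (Nat.lt_of_succ_lt h), node_succ N h]
        using N.cap_mid_pos e k h
    · obtain rfl : k = N.numFwd e - 1 := by omega
      have h1 : N.numFwd e - 1 + 1 = N.numFwd e := by omega
      have h2 : N.numFwd e - 1 < N.numFwd e := by omega
      have h3 : N.node e (N.numFwd e - 1 + 1 + 1) = Sum.inl (N.dst e) := by
        rw [h1, node_last]
      simpa only [linkCap, link, h3, node_succ N h2] using N.cap_last_pos e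

lemma Rmin_le_linkCap {e : E} {k : ℕ} (hk : k ≤ N.numFwd e) : N.Rmin e ≤ N.linkCap e k :=
  Finset.inf'_le _ (by simpa using Nat.lt_succ_of_le hk)

lemma Rmin_pos (e : E) : 0 < N.Rmin e := by
  rw [Rmin, Finset.lt_inf'_iff]
  intro k hk
  exact N.linkCap_pos (by simpa using Nat.lt_succ_iff.1 (Finset.mem_range.1 hk))

lemma Rmin_le_Rin (e : E) : N.Rmin e ≤ N.Rin e := N.Rmin_le_linkCap (Nat.zero_le _)

lemma exists_Rmin_eq_linkCap (e : E) : ∃ k ≤ N.numFwd e, N.Rmin e = N.linkCap e k := by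
  obtain ⟨k, hk, h⟩ := Finset.exists_mem_eq_inf' (s := Finset.range (N.numFwd e + 1))
    Finset.nonempty_range_add_one (N.linkCap e)
  exact ⟨k, by simpa using Nat.lt_succ_iff.1 (Finset.mem_range.1 hk), h⟩

variable [Fintype E]

/-- The summand `M * Rmin` of `T0` provides `M` of the multiples, and `Rin`, being at least `Rmin`,
the last one. -/
lemma mul_Rmin_le_threshold (e : E) : (N.numFwd e + 1) * N.Rmin e ≤ N.threshold := by
  have h1 : N.numFwd e * N.Rmin e ≤ N.T0 :=
    (Nat.le_add_right _ _).trans (Finset.le_sup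
      (f := fun e => N.numFwd e * N.Rmin e + N.numFwd e * (N.numFwd e - 1) / 2 * N.Rmax e)
      (Finset.mem_univ e))
  have h2 : N.Rin e ≤ Finset.univ.sup N.Rin := Finset.le_sup (Finset.mem_univ e)
  have h3 := N.Rmin_le_Rin e
  rw [threshold, add_mul, one_mul]
  omega

variable {N} [Fintype C] [DecidableEq V] [DecidableEq W]

/-- A link out of a forwarder is used by one tunnel only, by non-overlap, and at one position only,
by acyclicity. Work conservation of the links therefore makes each tunnel a tandem that does not
interact with the others. -/
lemma NonOverlapping.linkTotal_eq (hN : N.NonOverlapping)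
    (x : (e : E) → Fin (N.numFwd e) → C → ℕ) (e : E) (k : Fin (N.numFwd e)) :
    N.linkTotal x (N.link e (k + 1)) = ∑ c, x e k c := by
  classical
  rw [linkTotal, Finset.sum_eq_single e, Finset.sum_eq_single k]
  · simp
  · intro j _ hj
    rw [if_neg]
    intro h
    have h1 := congrArg Prod.fst h
    simp only [link, node_succ N j.2, node_succ N k.2, Sum.inr.injEq] at h1
    exact hj (N.fwd_injective e h1)
  · simp
  · intro e' _ he
    refine Finset.sum_eq_zero fun j _ => if_neg fun h => ?_
    have h1 : N.link e (k + 1) ∈ N.innerLinks e' ∩ N.innerLinks e :=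
      ⟨⟨j + 1, by omega, j.2, h⟩, ⟨k + 1, by omega, k.2, rfl⟩⟩
    rw [hN e' e he] at h1
    exact h1
  · simp

end Links

/-! ### Runs -/

/-- A sample path of the initially empty network under a work-conserving scheduling. -/
structure IsRun [Fintype E] [Fintype C] [DecidableEq V] (N : OverlayNetwork V W E C)
    (s : ℕ → State N) (d : ℕ → Decision E C) (φ : ℕ → Service N) (a : ℕ → V → C → ℕ) : Prop where
  start_Q : ∀ i c, (s 0).Q i c = 0
  start_X : ∀ e k c, (s 0).X e k c = 0
  step : ∀ t, s (t + 1) = N.next (s t) (d t) (φ t) (a t)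
  serve_le : ∀ t e k c, φ t e k c ≤ (s t).X e k c
  serve_total : ∀ t e (k : Fin (N.numFwd e)),
    ∑ c, φ t e k c = min (N.linkCap e (k + 1)) (∑ c, (s t).X e k c)

/-- Number of session `c` packets that cross the `k`-th link of tunnel `e` in one slot. -/
def crossing (N : OverlayNetwork V W E C) (d : Decision E C) (φ : Service N) (e : E) (c : C)
    (k : ℕ) : ℕ :=
  if k = 0 then d.inj e c else if h : k - 1 < N.numFwd e then φ e ⟨k - 1, h⟩ c else 0

/-- Number of session `c` packets of tunnel `e` that wait at its `k`-th forwarder. -/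
def State.waiting {N : OverlayNetwork V W E C} (s : State N) (e : E) (c : C) (k : ℕ) : ℕ :=
  if h : k < N.numFwd e then s.X e ⟨k, h⟩ c else 0

/-- Number of session `c` packets in flight on tunnel `e`. -/
def State.sessionF {N : OverlayNetwork V W E C} (s : State N) (e : E) (c : C) : ℕ :=
  ∑ k, s.X e k c

lemma crossing_zero (N : OverlayNetwork V W E C) (d : Decision E C) (φ : Service N) (e : E)
    (c : C) : N.crossing d φ e c 0 = d.inj e c := by simp [crossing]

lemma crossing_succ (N : OverlayNetwork V W E C) (d : Decision E C) (φ : Service N) {e : E}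
    (c : C) {k : ℕ} (hk : k < N.numFwd e) : N.crossing d φ e c (k + 1) = φ e ⟨k, hk⟩ c := by
  simp [crossing, hk]

lemma crossing_last (N : OverlayNetwork V W E C) (d : Decision E C) (φ : Service N) (e : E)
    (c : C) : N.crossing d φ e c (N.numFwd e) = N.output φ e c := by
  have h : N.numFwd e ≠ 0 := (N.numFwd_pos e).ne'
  have h' : N.numFwd e - 1 < N.numFwd e := by omega
  simp [crossing, output, h, h']

lemma State.sum_waiting {N : OverlayNetwork V W E C} (s : State N) (e : E) (c : C) :
    ∑ k ∈ Finset.range (N.numFwd e), s.waiting e c k = s.sessionF e c := by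
  rw [Finset.sum_range, sessionF]
  exact Finset.sum_congr rfl fun k _ => by simp [waiting]

lemma State.F_eq_sum_sessionF [Fintype C] {N : OverlayNetwork V W E C} (s : State N) (e : E) :
    s.F e = ∑ c, s.sessionF e c := by
  simp only [F, sessionF]
  exact Finset.sum_comm

lemma State.sessionF_le_F [Fintype C] {N : OverlayNetwork V W E C} (s : State N) (e : E)
    (c : C) : s.sessionF e c ≤ s.F e := by
  rw [F_eq_sum_sessionF]
  exact Finset.single_le_sum (f := fun c => s.sessionF e c) (fun _ _ => Nat.zero_le _)
    (Finset.mem_univ c)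

lemma State.total_waiting [Fintype C] {N : OverlayNetwork V W E C} (s : State N) (e : E) :
    ∑ k ∈ Finset.range (N.numFwd e), ∑ c, s.waiting e c k = s.F e := by
  rw [Finset.sum_comm, State.F_eq_sum_sessionF]
  exact Finset.sum_congr rfl fun c _ => s.sum_waiting e c

section Runs

variable [Fintype E] [Fintype C] [DecidableEq V] {N : OverlayNetwork V W E C}
  {s : ℕ → State N} {d : ℕ → Decision E C} {φ : ℕ → Service N} {a : ℕ → V → C → ℕ}

namespace IsRun

lemma waiting_succ (hs : IsRun N s d φ a) (e : E) (c : C) (t k : ℕ) (hk : k < N.numFwd e) :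
    (s (t + 1)).waiting e c k + N.crossing (d t) (φ t) e c (k + 1) =
      (s t).waiting e c k + N.crossing (d t) (φ t) e c k := by
  have h1 := hs.serve_le t e ⟨k, hk⟩ c
  rw [crossing_succ N _ _ _ hk, State.waiting, State.waiting, dif_pos hk, dif_pos hk, hs.step]
  simp only [next]
  rcases k with _ | k
  · simp only [crossing_zero, if_true]
    omega
  · rw [crossing_succ N _ _ _ (Nat.lt_of_succ_lt hk)]
    simp only [Nat.add_eq_zero_iff, one_ne_zero, and_false, if_false, Nat.add_sub_cancel]
    omega

lemma session_balance (hs : IsRun N s d φ a) (e : E) (c : C) (t n : ℕ) :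
    (s (t + n)).sessionF e c + ∑ i ∈ Finset.range n, N.output (φ (t + i)) e c =
      (s t).sessionF e c + ∑ i ∈ Finset.range n, (d (t + i)).inj e c := by
  have := tandem_balance (x := fun t => (s t).waiting e c)
    (y := fun t => N.crossing (d t) (φ t) e c) (hs.waiting_succ e c) t n (Nat.zero_le _)
  simpa only [← Finset.range_eq_Ico, State.sum_waiting, crossing_last, crossing_zero] using this

lemma total_succ (hs : IsRun N s d φ a) (e : E) (t k : ℕ) (hk : k < N.numFwd e) :
    ∑ c, (s (t + 1)).waiting e c k + ∑ c, N.crossing (d t) (φ t) e c (k + 1) =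
      ∑ c, (s t).waiting e c k + ∑ c, N.crossing (d t) (φ t) e c k := by
  simp only [← Finset.sum_add_distrib]
  exact Finset.sum_congr rfl fun c _ => hs.waiting_succ e c t k hk

lemma total_crossing_succ (hs : IsRun N s d φ a) (e : E) (t k : ℕ) (hk : k < N.numFwd e) :
    ∑ c, N.crossing (d t) (φ t) e c (k + 1) =
      min (N.linkCap e (k + 1)) (∑ c, (s t).waiting e c k) := by
  simp only [crossing_succ N _ _ _ hk, State.waiting, dif_pos hk]
  exact hs.serve_total t e ⟨k, hk⟩

lemma balance (hs : IsRun N s d φ a) (e : E) (t n : ℕ) :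
    (s (t + n)).F e + ∑ i ∈ Finset.range n, ∑ c, N.output (φ (t + i)) e c =
      (s t).F e + ∑ i ∈ Finset.range n, ∑ c, (d (t + i)).inj e c := by
  have := tandem_balance (x := fun t k => ∑ c, (s t).waiting e c k)
    (y := fun t k => ∑ c, N.crossing (d t) (φ t) e c k) (hs.total_succ e) t n (Nat.zero_le _)
  simpa only [← Finset.range_eq_Ico, State.total_waiting, crossing_last, crossing_zero] using this

lemma throughput (hs : IsRun N s d φ a) (e : E) (t n : ℕ)
    (hin : ∀ i < n, N.Rmin e ≤ ∑ c, (d (t + i)).inj e c ∨ N.threshold ≤ (s (t + i)).F e) :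
    N.Rmin e * n ≤ ∑ i ∈ Finset.range n, ∑ c, (d (t + i)).inj e c + (s t).F e := by
  have := tandem_throughput (x := fun t k => ∑ c, (s t).waiting e c k)
    (y := fun t k => ∑ c, N.crossing (d t) (φ t) e c k)
    (cap := fun k => N.linkCap e (k + 1)) (N.mul_Rmin_le_threshold e) (hs.total_succ e)
    (hs.total_crossing_succ e) (fun k hk => N.Rmin_le_linkCap hk) t n
    (by simpa only [State.total_waiting, crossing_zero] using hin)
  simpa only [State.total_waiting, crossing_zero] using this

lemma total_output_le (hs : IsRun N s d φ a) (e : E) (t : ℕ) :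
    ∑ c, N.output (φ t) e c ≤ N.linkCap e (N.numFwd e) := by
  have h := hs.total_crossing_succ e t (N.numFwd e - 1) (Nat.sub_lt (N.numFwd_pos e) one_pos)
  rw [show N.numFwd e - 1 + 1 = N.numFwd e from Nat.sub_add_cancel (N.numFwd_pos e)] at h
  simp only [crossing_last] at h
  rw [h]
  exact min_le_left _ _

lemma output_le (hs : IsRun N s d φ a) (e : E) (c : C) (t : ℕ) :
    N.output (φ t) e c ≤ N.linkCap e (N.numFwd e) :=
  (Finset.single_le_sum (f := fun c => N.output (φ t) e c) (fun _ _ => Nat.zero_le _)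
    (Finset.mem_univ c)).trans (hs.total_output_le e t)

/-- The total output of an initially empty tunnel is limited by the bottleneck. -/
lemma sum_output_le (hs : IsRun N s d φ a) (e : E)
    (hin : ∀ t, ∑ c, (d t).inj e c ≤ N.Rin e) (n : ℕ) :
    ∑ i ∈ Finset.range n, ∑ c, N.output (φ i) e c ≤ n * N.Rmin e := by
  have h0 : (s 0).F e = 0 := by simp [State.F, hs.start_X]
  -- Cut the tunnel at a bottleneck link: starting empty, it cannot put out more than has crossed
  -- this link. If the bottleneck is the input link, `k = 0`, the crossings are the injections and
  -- `hin` limits them.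
  obtain ⟨k, hk, hR⟩ := N.exists_Rmin_eq_linkCap e
  have h1 := tandem_balance (x := fun t k => ∑ c, (s t).waiting e c k)
    (y := fun t k => ∑ c, N.crossing (d t) (φ t) e c k) (hs.total_succ e) 0 n hk
  simp only [crossing_last, zero_add] at h1
  have h2 : ∑ j ∈ Finset.Ico k (N.numFwd e), ∑ c, (s 0).waiting e c j = 0 := by
    rw [← State.total_waiting, Finset.sum_eq_zero_iff] at h0
    exact Finset.sum_eq_zero fun j hj => h0 j (by simp at hj ⊢; omega)
  have h3 : ∑ i ∈ Finset.range n, ∑ c, N.crossing (d i) (φ i) e c k ≤ n * N.Rmin e := by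
    rw [← smul_eq_mul, ← Finset.card_range n, Finset.card_range n]
    refine (Finset.sum_le_card_nsmul _ _ (N.Rmin e) fun i _ => ?_).trans (by simp)
    rw [hR]
    rcases k with _ | k
    · simp only [crossing_zero]
      exact hin i
    · rw [hs.total_crossing_succ e i k hk]
      exact min_le_left _ _
  omega

end IsRun

end Runs

end OverlayNetwork


/-! ### Backpressure against a flow on one tunnel, and quadratic drift -/

/-- Over `K` slots, a backpressure decision collects, up to a bounded loss per unit of backlog, at
least as much differential backlog as any flow `f` that respects the capacity `R`. -/
lemma backpressure_comparison {C : Type*} [Fintype C] {K : ℕ} {R S H G : ℝ} {q δ₀ f : C → ℝ}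
    {δ m : ℕ → C → ℝ} (hR : 0 ≤ R) (hRS : R ≤ S) (hH : 0 ≤ H) (hG : 0 ≤ G)
    (hδ : ∀ i < K, ∀ c, |δ i c - δ₀ c| ≤ G) (hm : ∀ i c, 0 ≤ m i c)
    (hmS : ∀ i < K, ∑ c, m i c ≤ S)
    (hmax : ∀ i < K, ∀ c, 0 < m i c → 0 < δ i c ∧ ∀ c', δ i c' ≤ δ i c)
    (hthr : (∀ i < K, ∃ c, 0 < δ i c) → R * K ≤ ∑ i ∈ Finset.range K, ∑ c, m i c + H)
    (hf : ∀ c, 0 ≤ f c) (hfR : ∑ c, f c ≤ R) (hq : ∀ c, 0 ≤ q c) (hδq : ∀ c, δ₀ c ≤ q c) :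
    K * ∑ c, f c * δ₀ c ≤
      ∑ c, (∑ i ∈ Finset.range K, m i c) * δ₀ c + H * ∑ c, q c + 2 * G * (K * S) := by
  set n := ∑ i ∈ Finset.range K, ∑ c, m i c with hn
  have hS : 0 ≤ S := hR.trans hRS
  have hnS : n ≤ K * S := by
    refine (Finset.sum_le_card_nsmul _ _ S fun i hi => hmS i (Finset.mem_range.1 hi)).trans ?_
    simp
  have hn0 : 0 ≤ n := Finset.sum_nonneg fun i _ => Finset.sum_nonneg fun c _ => hm i c
  have hq0 : 0 ≤ ∑ c, q c := Finset.sum_nonneg fun c _ => hq c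
  have hK : (0 : ℝ) ≤ K := Nat.cast_nonneg K
  have hswap : ∑ c, (∑ i ∈ Finset.range K, m i c) * δ₀ c =
      ∑ i ∈ Finset.range K, ∑ c, m i c * δ₀ c := by
    simp only [Finset.sum_mul]
    exact Finset.sum_comm
  have hlow : ∀ A : ℝ, (∀ i < K, ∀ c, 0 < m i c → A ≤ δ₀ c) →
      n * A ≤ ∑ c, (∑ i ∈ Finset.range K, m i c) * δ₀ c := by
    intro A hA
    rw [hswap, hn, Finset.sum_mul]
    refine Finset.sum_le_sum fun i hi => ?_
    rw [Finset.sum_mul]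
    refine Finset.sum_le_sum fun c _ => ?_
    rcases (hm i c).eq_or_lt with h | h
    · simp [← h]
    · exact mul_le_mul_of_nonneg_left (hA i (Finset.mem_range.1 hi) c h) h.le
  have hup : ∀ A : ℝ, 0 ≤ A → (∀ c, δ₀ c ≤ A) → ∑ c, f c * δ₀ c ≤ R * A := by
    intro A hA h
    calc ∑ c, f c * δ₀ c ≤ ∑ c, f c * A :=
          Finset.sum_le_sum fun c _ => mul_le_mul_of_nonneg_left (h c) (hf c)
      _ = (∑ c, f c) * A := by rw [Finset.sum_mul]
      _ ≤ R * A := mul_le_mul_of_nonneg_right hfR hA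
  -- If no initial differential backlog exceeds the variation `G`, the flow gains at most `K * S *
  -- G` and backpressure loses at most as much, which `2 * G * (K * S)` covers.
  by_cases hW : ∀ c, δ₀ c ≤ G
  · have h1 := hup G hG hW
    have h2 := hlow (-G) fun i hi c hc => by
      have := (abs_le.1 (hδ i hi c)).2
      linarith [(hmax i hi c hc).1]
    have h3 : K * ∑ c, f c * δ₀ c ≤ K * (S * G) :=
      mul_le_mul_of_nonneg_left (h1.trans (mul_le_mul_of_nonneg_right hRS hG)) hK
    have h4 := mul_le_mul_of_nonneg_right hnS hG
    have h5 := mul_nonneg hH hq0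
    nlinarith
  -- Otherwise the maximum `w > G` keeps its session positive during the whole window, so the
  -- throughput hypothesis applies. Every session served is maximal at its time, hence within `2 *
  -- G` of `w` at the start. The `H` packets of missing throughput cost `H * w`, and `w` is at most
  -- the sum of `q`.
  · push Not at hW
    obtain ⟨c₁, hc₁⟩ := hW
    have : Nonempty C := ⟨c₁⟩
    obtain ⟨c₀, hc₀⟩ := Finite.exists_max δ₀
    set w := δ₀ c₀ with hw
    have hwG : G < w := hc₁.trans_le (hc₀ c₁)
    have h1 := hup w (hG.trans hwG.le) hc₀
    have h2 := hlow (w - 2 * G) fun i hi c hc => by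
      have h3 := (abs_le.1 (hδ i hi c)).2
      have h4 := (abs_le.1 (hδ i hi c₀)).1
      linarith [(hmax i hi c hc).2 c₀]
    have h3 := hthr fun i hi => ⟨c₀, by linarith [(abs_le.1 (hδ i hi c₀)).1]⟩
    have h4 : w ≤ ∑ c, q c :=
      (hδq c₀).trans (Finset.single_le_sum (f := q) (fun c _ => hq c) (Finset.mem_univ c₀))
    have h5 := mul_le_mul_of_nonneg_left h1 hK
    have h6 := mul_le_mul_of_nonneg_left h4 hH
    have h7 := mul_le_mul_of_nonneg_right h3 (hG.trans hwG.le)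
    have h8 := mul_le_mul_of_nonneg_left hnS hG
    nlinarith

/-- The quadratic drift of a queue with service `m` and input `x`. -/
lemma sq_le_of_le_sub_add {q q' m x B : ℕ} (h : q' ≤ (q - m) + x) (hm : m ≤ B) (hx : x ≤ B) :
    (q' : ℝ) ^ 2 ≤ (q : ℝ) ^ 2 + 2 * (B : ℝ) ^ 2 + 2 * (q * ((x : ℝ) - m)) := by
  have hx' : (x : ℝ) ≤ B := by exact_mod_cast hx
  have hm' : (m : ℝ) ≤ B := by exact_mod_cast hm
  have hq : (0 : ℝ) ≤ q := Nat.cast_nonneg q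
  have hx0 : (0 : ℝ) ≤ x := Nat.cast_nonneg x
  have hm0 : (0 : ℝ) ≤ m := Nat.cast_nonneg m
  have hx2 : (x : ℝ) ^ 2 ≤ (B : ℝ) ^ 2 := pow_le_pow_left₀ hx0 hx' 2
  have hm2 : (m : ℝ) ^ 2 ≤ (B : ℝ) ^ 2 := pow_le_pow_left₀ hm0 hm' 2
  have hq'0 : (0 : ℝ) ≤ q' := Nat.cast_nonneg q'
  rcases le_total m q with hmq | hmq
  · have h1 : (q' : ℝ) ≤ (q - m) + x := by
      have : q' + m ≤ q + x := by omega
      have : (q' : ℝ) + m ≤ q + x := by exact_mod_cast this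
      linarith
    have h2 : (q' : ℝ) ^ 2 ≤ ((q - m) + x) ^ 2 := pow_le_pow_left₀ hq'0 h1 2
    nlinarith [mul_nonneg hx0 hm0]
  -- Here the queue empties; the negative part of the cross term is absorbed by `q ^ 2 - 2 * q * m ≥
  -- -m ^ 2 ≥ -B ^ 2`.
  · have h1 : (q' : ℝ) ≤ x := by
      have : q' ≤ x := by omega
      exact_mod_cast this
    have h2 : (q' : ℝ) ^ 2 ≤ (x : ℝ) ^ 2 := pow_le_pow_left₀ hq'0 h1 2
    nlinarith [mul_nonneg hx0 hq, sq_nonneg ((q : ℝ) - m)]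

lemma Finset.sum_mul_sum_fiber {ι κ : Type*} [Fintype ι] [Fintype κ] [DecidableEq κ] (p : ι → κ)
    (g : κ → ℝ) (h : ι → ℝ) :
    ∑ i, g i * ∑ e with p e = i, h e = ∑ e, g (p e) * h e := by
  rw [← Finset.sum_fiberwise (Finset.univ : Finset ι) p]
  refine Finset.sum_congr rfl fun i _ => ?_
  rw [Finset.mul_sum]
  refine Finset.sum_congr rfl fun e he => ?_
  rw [(Finset.mem_filter.1 he).2]

/-! ### BP-T on a sample path: bounded tunnels and Lyapunov drift -/

namespace OverlayNetwork

variable {V W E C : Type*} [Fintype E] [Fintype C] {N : OverlayNetwork V W E C}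

/-- The decision that BP-T takes in one slot. -/
def IsBPTDecision [DecidableEq C] (s : State N) (d : Decision E C) : Prop :=
  ∀ e, ∃ c' : C,
    (∀ c, (s.Q (N.src e) c : ℤ) - s.Q (N.dst e) c ≤ s.Q (N.src e) c' - s.Q (N.dst e) c') ∧
    (∀ c, d.mu e c =
      if c = c' ∧ s.Q (N.dst e) c' < s.Q (N.src e) c' ∧ s.F e ≤ N.threshold
      then N.Rin e else 0) ∧
    (∀ c, d.inj e c = d.mu e c)

namespace IsBPTDecision

variable [DecidableEq C] {s : State N} {d : Decision E C}

lemma total_mu_le (h : IsBPTDecision s d) (e : E) : ∑ c, d.mu e c ≤ N.Rin e := by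
  obtain ⟨c', -, h2, -⟩ := h e
  simp only [h2, ite_and]
  rw [Finset.sum_ite_eq' Finset.univ c']
  simp only [Finset.mem_univ, if_true]
  split_ifs <;> simp

lemma inj_eq_mu (h : IsBPTDecision s d) (e : E) (c : C) : d.inj e c = d.mu e c := by
  obtain ⟨c', -, -, h3⟩ := h e
  exact h3 c

lemma total_inj_le (h : IsBPTDecision s d) (e : E) : ∑ c, d.inj e c ≤ N.Rin e := by
  simpa only [h.inj_eq_mu] using h.total_mu_le e

lemma mu_eq_zero (h : IsBPTDecision s d) {e : E} (hF : N.threshold < s.F e) (c : C) :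
    d.mu e c = 0 := by
  obtain ⟨c', -, h2, -⟩ := h e
  rw [h2, if_neg]
  rintro ⟨-, -, h4⟩
  omega

lemma of_mu_pos (h : IsBPTDecision s d) {e : E} {c : C} (hc : 0 < d.mu e c) :
    s.Q (N.dst e) c < s.Q (N.src e) c ∧
      ∀ c', (s.Q (N.src e) c' : ℤ) - s.Q (N.dst e) c' ≤ s.Q (N.src e) c - s.Q (N.dst e) c := by
  obtain ⟨c', h1, h2, -⟩ := h e
  rw [h2] at hc
  split_ifs at hc with h3
  · obtain ⟨rfl, h4, -⟩ := h3
    exact ⟨h4, h1⟩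
  · omega

lemma total_mu_eq (h : IsBPTDecision s d) {e : E} (hF : s.F e ≤ N.threshold)
    (hc : ∃ c, s.Q (N.dst e) c < s.Q (N.src e) c) : ∑ c, d.mu e c = N.Rin e := by
  obtain ⟨c', h1, h2, -⟩ := h e
  obtain ⟨c, hc⟩ := hc
  have h4 : s.Q (N.dst e) c' < s.Q (N.src e) c' := by
    have := h1 c
    omega
  simp [h2, hF, h4]

end IsBPTDecision

variable [DecidableEq V]

/-- A bound on the change of a router queue in one slot. -/
def stepBound (N : OverlayNetwork V W E C) (Amax : ℕ) : ℕ :=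
  ∑ e, N.Rin e + (∑ e, N.linkCap e (N.numFwd e) + Amax)

/-- A bound on the backlogs of tunnels under BP-T. -/
def tunnelBound (N : OverlayNetwork V W E C) : ℕ := N.threshold + ∑ e, N.Rin e

namespace IsRun

variable {s : ℕ → State N} {d : ℕ → Decision E C} {φ : ℕ → Service N} {a : ℕ → V → C → ℕ}
  {Amax : ℕ}

lemma Q_dest (hs : IsRun N s d φ a) (c : C) (t : ℕ) : (s t).Q (N.dest c) c = 0 := by
  cases t with
  | zero => exact hs.start_Q _ _
  | succ t => simp [hs.step, next]

lemma Q_succ_le (hs : IsRun N s d φ a) (i : V) (c : C) (t : ℕ) :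
    (s (t + 1)).Q i c ≤ ((s t).Q i c - N.routedOut (d t).mu i c) +
      (∑ e with N.dst e = i, N.output (φ t) e c + a t i c) := by
  rw [hs.step]
  simp only [next]
  split_ifs
  · exact Nat.zero_le _
  · omega

/-- Grouping all service of the window before all its input can only waste more service, so the
one-slot recursion survives as an inequality over `n` slots. -/
lemma Q_add_le (hs : IsRun N s d φ a) (i : V) (c : C) (t n : ℕ) :
    (s (t + n)).Q i c ≤ ((s t).Q i c - ∑ k ∈ Finset.range n, N.routedOut (d (t + k)).mu i c) +
      ∑ k ∈ Finset.range n,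
        (∑ e with N.dst e = i, N.output (φ (t + k)) e c + a (t + k) i c) := by
  induction n with
  | zero => simp
  | succ n ih =>
    have := hs.Q_succ_le i c (t + n)
    rw [Finset.sum_range_succ, Finset.sum_range_succ, ← add_assoc t n 1]
    omega

lemma routedOut_le {m : E → C → ℕ} (hm : ∀ e, ∑ c, m e c ≤ N.Rin e) (i : V) (c : C) :
    N.routedOut m i c ≤ ∑ e, N.Rin e :=
  (Finset.sum_le_sum_of_subset (Finset.filter_subset _ _)).trans
    (Finset.sum_le_sum fun e _ => (Finset.single_le_sum (f := m e) (fun _ _ => Nat.zero_le _)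
      (Finset.mem_univ c)).trans (hm e))

lemma inflow_le (hs : IsRun N s d φ a) (ha : ∀ t i c, a t i c ≤ Amax) (i : V) (c : C) (t : ℕ) :
    ∑ e with N.dst e = i, N.output (φ t) e c + a t i c ≤ N.stepBound Amax := by
  have h1 : ∑ e with N.dst e = i, N.output (φ t) e c ≤ ∑ e, N.linkCap e (N.numFwd e) :=
    (Finset.sum_le_sum_of_subset (Finset.filter_subset _ _)).trans
      (Finset.sum_le_sum fun e _ => hs.output_le e c t)
  have h2 := ha t i c
  rw [stepBound]
  omega

lemma Q_succ_le_add (hs : IsRun N s d φ a) (ha : ∀ t i c, a t i c ≤ Amax) (i : V) (c : C)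
    (t : ℕ) : (s (t + 1)).Q i c ≤ (s t).Q i c + N.stepBound Amax := by
  have h1 := hs.Q_succ_le i c t
  have h2 := hs.inflow_le ha i c t
  omega

/-- This crude bound serves for integrability at each fixed time. -/
lemma Q_le_mul (hs : IsRun N s d φ a) (ha : ∀ t i c, a t i c ≤ Amax) (i : V) (c : C) (t : ℕ) :
    (s t).Q i c ≤ t * N.stepBound Amax := by
  induction t with
  | zero => simp [hs.start_Q]
  | succ t ih =>
    have := hs.Q_succ_le_add ha i c t
    rw [add_mul]
    omega

lemma Q_le_succ_add (hs : IsRun N s d φ a) (hmu : ∀ t e, ∑ c, (d t).mu e c ≤ N.Rin e) (i : V)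
    (c : C) (t : ℕ) : (s t).Q i c ≤ (s (t + 1)).Q i c + N.stepBound Amax := by
  by_cases hi : i = N.dest c
  · simp [hi, hs.Q_dest]
  · have h1 : N.routedOut (d t).mu i c ≤ ∑ e, N.Rin e := routedOut_le (hmu t) i c
    have h2 : (s (t + 1)).Q i c = ((s t).Q i c - N.routedOut (d t).mu i c) +
        ∑ e with N.dst e = i, N.output (φ t) e c + a t i c := by
      rw [hs.step]
      simp [next, hi]
    rw [stepBound]
    omega

lemma abs_Q_sub_le (hs : IsRun N s d φ a) (ha : ∀ t i c, a t i c ≤ Amax)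
    (hmu : ∀ t e, ∑ c, (d t).mu e c ≤ N.Rin e) (i : V) (c : C) (t n : ℕ) :
    |((s (t + n)).Q i c : ℝ) - (s t).Q i c| ≤ n * N.stepBound Amax := by
  induction n with
  | zero => simp
  | succ n ih =>
    have h1 : ((s (t + n + 1)).Q i c : ℝ) ≤ (s (t + n)).Q i c + N.stepBound Amax := by
      exact_mod_cast hs.Q_succ_le_add ha i c (t + n)
    have h2 : ((s (t + n)).Q i c : ℝ) ≤ (s (t + n + 1)).Q i c + N.stepBound Amax := by
      exact_mod_cast hs.Q_le_succ_add hmu i c (t + n)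
    rw [abs_le] at ih ⊢
    rw [← add_assoc]
    push_cast
    constructor <;> nlinarith

section BPT

variable [DecidableEq C]

/-- Above the threshold nothing enters, so a tunnel exceeds it by at most one slot's injection. -/
lemma F_le_tunnelBound (hs : IsRun N s d φ a) (hb : ∀ t, IsBPTDecision (s t) (d t)) (e : E)
    (t : ℕ) : (s t).F e ≤ N.tunnelBound := by
  have hR : N.Rin e ≤ ∑ e, N.Rin e :=
    Finset.single_le_sum (f := N.Rin) (fun _ _ => Nat.zero_le _) (Finset.mem_univ e)
  induction t with
  | zero => simp [State.F, hs.start_X]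
  | succ t ih =>
    have h1 := hs.balance e t 1
    simp only [Finset.range_one, Finset.sum_singleton, add_zero] at h1
    rcases le_or_gt ((s t).F e) N.threshold with h | h
    · have := (hb t).total_inj_le e
      rw [tunnelBound]
      omega
    · have h2 : ∑ c, (d t).inj e c = 0 :=
        Finset.sum_eq_zero fun c _ => by rw [(hb t).inj_eq_mu, (hb t).mu_eq_zero h]
      omega

/-- Comparison of BP-T with a flow, for one tunnel and a window of `K` slots. -/
lemma tunnel_comparison (hs : IsRun N s d φ a) (hb : ∀ t, IsBPTDecision (s t) (d t))
    (ha : ∀ t i c, a t i c ≤ Amax) {f : C → ℝ} (e : E) (hf : ∀ c, 0 ≤ f c)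
    (hfR : ∑ c, f c ≤ N.Rmin e) (t K : ℕ) :
    K * ∑ c, f c * ((s t).Q (N.src e) c - (s t).Q (N.dst e) c) ≤
      ∑ c, (∑ k ∈ Finset.range K, ((d (t + k)).mu e c : ℝ)) *
        ((s t).Q (N.src e) c - (s t).Q (N.dst e) c) +
      N.tunnelBound * ∑ c, ((s t).Q (N.src e) c : ℝ) +
      2 * (2 * (K * N.stepBound Amax)) * (K * N.Rin e) := by
  have hmu : ∀ t e, ∑ c, (d t).mu e c ≤ N.Rin e := fun t e => (hb t).total_mu_le e
  refine backpressure_comparison (R := N.Rmin e)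
    (δ := fun k c => ((s (t + k)).Q (N.src e) c : ℝ) - (s (t + k)).Q (N.dst e) c)
    (m := fun k c => ((d (t + k)).mu e c : ℝ))
    (Nat.cast_nonneg _) (by exact_mod_cast N.Rmin_le_Rin e) (Nat.cast_nonneg _) (by positivity)
    ?_ (fun _ _ => Nat.cast_nonneg _) (fun k _ => by exact_mod_cast hmu (t + k) e) ?_ ?_ hf hfR
    (fun _ => Nat.cast_nonneg _) (fun c => sub_le_self _ (Nat.cast_nonneg _))
  -- A differential backlog involves two queues, each moving by at most `K * stepBound` within the
  -- window; their sum is the constant `G` of the comparison.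
  · intro k hk c
    have h1 := abs_le.1 (hs.abs_Q_sub_le ha hmu (N.src e) c t k)
    have h2 := abs_le.1 (hs.abs_Q_sub_le ha hmu (N.dst e) c t k)
    have h3 : (k : ℝ) * N.stepBound Amax ≤ K * N.stepBound Amax :=
      mul_le_mul_of_nonneg_right (by exact_mod_cast hk.le) (Nat.cast_nonneg _)
    rw [abs_le]
    constructor <;> linarith
  · intro k hk c hc
    obtain ⟨h1, h2⟩ := (hb (t + k)).of_mu_pos (by exact_mod_cast hc)
    exact ⟨sub_pos.2 (by exact_mod_cast h1), fun c' => by exact_mod_cast h2 c'⟩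
  -- While some differential backlog is positive, BP-T either injects `Rin ≥ Rmin` packets or finds
  -- the tunnel above the threshold, which is the alternative that `throughput` asks for.
  · intro hpos
    have h1 := hs.throughput e t K (fun k hk => by
      rcases le_or_gt ((s (t + k)).F e) N.threshold with h | h
      · left
        obtain ⟨c, hc⟩ := hpos k hk
        simp only [(hb (t + k)).inj_eq_mu]
        rw [(hb (t + k)).total_mu_eq h ⟨c, by exact_mod_cast sub_pos.1 hc⟩]
        exact N.Rmin_le_Rin e
      · exact Or.inr h.le)
    have h2 := hs.F_le_tunnelBound hb e t
    simp only [(hb _).inj_eq_mu] at h1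
    exact_mod_cast h1.trans (Nat.add_le_add_left h2 _)

variable [Fintype V]

/-- Drift of the quadratic Lyapunov function over `K` slots, in comparison with a flow `f`. -/
lemma drift (hs : IsRun N s d φ a) (hb : ∀ t, IsBPTDecision (s t) (d t))
    (ha : ∀ t i c, a t i c ≤ Amax) {f : E → C → ℝ} {g : V → C → ℝ} (hf : ∀ e c, 0 ≤ f e c)
    (hfR : ∀ e, ∑ c, f e c ≤ N.Rmin e)
    (hg : ∀ i c, i ≠ N.dest c →
      g i c ≤ ∑ e with N.src e = i, f e c - ∑ e with N.dst e = i, f e c) (t K : ℕ) :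
    ∑ i, ∑ c, ((s (t + K)).Q i c : ℝ) ^ 2 ≤ ∑ i, ∑ c, ((s t).Q i c : ℝ) ^ 2 +
      (Fintype.card V * Fintype.card C * (2 * (K * N.stepBound Amax : ℝ) ^ 2) +
        2 * ∑ e, 2 * (2 * (K * N.stepBound Amax)) * (K * N.Rin e : ℝ)) +
      2 * ∑ i, ∑ c, (s t).Q i c * (∑ k ∈ Finset.range K, (a (t + k) i c : ℝ) +
        2 * (Fintype.card E * N.tunnelBound) - K * g i c) := by
  have hmu : ∀ t e, ∑ c, (d t).mu e c ≤ N.Rin e := fun t e => (hb t).total_mu_le e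
  set M : E → C → ℝ := fun e c => ∑ k ∈ Finset.range K, ((d (t + k)).mu e c : ℝ) with hM
  set Φ : E → C → ℝ := fun e c => ∑ k ∈ Finset.range K, (N.output (φ (t + k)) e c : ℝ) with hΦ
  set q : V → C → ℝ := fun i c => ((s t).Q i c : ℝ) with hq
  have hq0 : ∀ i c, 0 ≤ q i c := fun i c => Nat.cast_nonneg _
  -- A tunnel delivers in the window at most what enters it then plus its initial content.
  have hΦM : ∀ e c, Φ e c ≤ M e c + N.tunnelBound := by
    intro e c
    have h1 := hs.session_balance e c t K
    have h2 := ((s t).sessionF_le_F e c).trans (hs.F_le_tunnelBound hb e t)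
    simp only [(hb _).inj_eq_mu] at h1
    simp only [hM, hΦ]
    have h3 : ∑ k ∈ Finset.range K, N.output (φ (t + k)) e c ≤
      ∑ k ∈ Finset.range K, (d (t + k)).mu e c + N.tunnelBound := by omega
    exact_mod_cast h3
  have hone : ∀ i c, ((s (t + K)).Q i c : ℝ) ^ 2 ≤ q i c ^ 2 +
      2 * (K * N.stepBound Amax : ℝ) ^ 2 + 2 * (q i c * (∑ k ∈ Finset.range K, (a (t + k) i c : ℝ) +
        ∑ e with N.dst e = i, Φ e c - ∑ e with N.src e = i, M e c)) := by
    intro i c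
    have h1 := sq_le_of_le_sub_add (B := K * N.stepBound Amax) (hs.Q_add_le i c t K)
      ((Finset.sum_le_card_nsmul _ _ (N.stepBound Amax) fun k _ =>
        (routedOut_le (hmu (t + k)) i c).trans (Nat.le_add_right _ _)).trans (by simp))
      ((Finset.sum_le_card_nsmul _ _ (N.stepBound Amax) fun k _ =>
        hs.inflow_le ha i c (t + k)).trans (by simp))
    push_cast [routedOut] at h1
    refine h1.trans (le_of_eq ?_)
    rw [Finset.sum_add_distrib]
    simp only [hM, hΦ, hq]
    rw [Finset.sum_comm (s := Finset.range K), Finset.sum_comm (s := Finset.range K)]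
    ring
  -- One `tunnelBound` is due to the initial content, which may burden the end router; the other is
  -- the throughput missing in `tunnel_comparison`, weighted by the backlog at the source. Neither
  -- grows with `K`.
  have htun : ∀ e, ∑ c, (q (N.dst e) c * Φ e c - q (N.src e) c * M e c) ≤
      N.tunnelBound * ∑ c, q (N.dst e) c + N.tunnelBound * ∑ c, q (N.src e) c +
        2 * (2 * (K * N.stepBound Amax)) * (K * N.Rin e : ℝ) -
        K * ∑ c, f e c * (q (N.src e) c - q (N.dst e) c) := by
    intro e
    have h1 := hs.tunnel_comparison hb ha e (hf e) (hfR e) t K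
    have h2 : ∑ c, (q (N.dst e) c * Φ e c - q (N.src e) c * M e c) ≤
        ∑ c, (N.tunnelBound * q (N.dst e) c - M e c * (q (N.src e) c - q (N.dst e) c)) := by
      refine Finset.sum_le_sum fun c _ => ?_
      nlinarith [mul_le_mul_of_nonneg_left (hΦM e c) (hq0 (N.dst e) c)]
    rw [Finset.sum_sub_distrib (f := fun c => N.tunnelBound * q (N.dst e) c),
      ← Finset.mul_sum] at h2
    linarith
  have hbound : ∀ v : V, ∑ c, q v c ≤ ∑ i, ∑ c, q i c := fun v =>
    Finset.single_le_sum (f := fun i => ∑ c, q i c)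
      (fun i _ => Finset.sum_nonneg fun c _ => hq0 i c) (Finset.mem_univ v)
  have hexch : ∀ (p : E → V) (x : E → C → ℝ), ∑ i, ∑ c, q i c * ∑ e with p e = i, x e c =
      ∑ e, ∑ c, q (p e) c * x e c := by
    intro p x
    rw [Finset.sum_comm, Finset.sum_comm (s := (Finset.univ : Finset E))]
    exact Finset.sum_congr rfl fun c _ =>
      Finset.sum_mul_sum_fiber p (fun i => q i c) (fun e => x e c)
  have hgq : ∑ i, ∑ c, q i c * g i c ≤ ∑ e, ∑ c, f e c * (q (N.src e) c - q (N.dst e) c) := by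
    have h1 : ∑ i, ∑ c, q i c * g i c ≤ ∑ i, ∑ c, q i c *
        (∑ e with N.src e = i, f e c - ∑ e with N.dst e = i, f e c) := by
      refine Finset.sum_le_sum fun i _ => Finset.sum_le_sum fun c _ => ?_
      -- The flow condition is void at the destination, but the queue there is zero.
      by_cases hi : i = N.dest c
      · have : q i c = 0 := by simp [hq, hi, hs.Q_dest]
        simp [this]
      · exact mul_le_mul_of_nonneg_left (hg i c hi) (hq0 i c)
    refine h1.trans (le_of_eq ?_)
    simp only [mul_sub, Finset.sum_sub_distrib, hexch]
    simp only [mul_comm]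
  have hmid : ∑ e, ∑ c, (q (N.dst e) c * Φ e c - q (N.src e) c * M e c) ≤
      2 * (Fintype.card E * N.tunnelBound) * ∑ i, ∑ c, q i c +
        ∑ e, 2 * (2 * (K * N.stepBound Amax)) * (K * N.Rin e : ℝ) -
        K * ∑ i, ∑ c, q i c * g i c := by
    have h1 : ∀ e, ∑ c, (q (N.dst e) c * Φ e c - q (N.src e) c * M e c) ≤
      2 * N.tunnelBound * ∑ i, ∑ c, q i c +
        2 * (2 * (K * N.stepBound Amax)) * (K * N.Rin e : ℝ) -
        K * ∑ c, f e c * (q (N.src e) c - q (N.dst e) c) := by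
      intro e
      have h2 := htun e
      have h0 := Nat.cast_nonneg (α := ℝ) N.tunnelBound
      have h3 := mul_le_mul_of_nonneg_left (hbound (N.src e)) h0
      have h4 := mul_le_mul_of_nonneg_left (hbound (N.dst e)) h0
      linarith
    have h2 := Finset.sum_le_sum fun e (_ : e ∈ Finset.univ) => h1 e
    rw [Finset.sum_sub_distrib, Finset.sum_add_distrib, ← Finset.mul_sum (s := Finset.univ) (a := (K : ℝ)),
      Finset.sum_const, Finset.card_univ, nsmul_eq_mul] at h2
    have h3 := mul_le_mul_of_nonneg_left hgq (Nat.cast_nonneg (α := ℝ) K)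
    linarith
  have hsum := Finset.sum_le_sum fun i (_ : i ∈ (Finset.univ : Finset V)) =>
    Finset.sum_le_sum fun c (_ : c ∈ (Finset.univ : Finset C)) => hone i c
  have h1 : ∑ i, ∑ c, (q i c ^ 2 + 2 * (K * N.stepBound Amax : ℝ) ^ 2 +
      2 * (q i c * (∑ k ∈ Finset.range K, (a (t + k) i c : ℝ) +
        ∑ e with N.dst e = i, Φ e c - ∑ e with N.src e = i, M e c))) =
      ∑ i, ∑ c, q i c ^ 2 +
        Fintype.card V * Fintype.card C * (2 * (K * N.stepBound Amax : ℝ) ^ 2) +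
        2 * (∑ i, ∑ c, q i c * ∑ k ∈ Finset.range K, (a (t + k) i c : ℝ) +
          ∑ e, ∑ c, (q (N.dst e) c * Φ e c - q (N.src e) c * M e c)) := by
    have h2 := hexch N.dst Φ
    have h3 := hexch N.src M
    simp only [mul_add (q _ _), mul_sub (q _ _), Finset.sum_add_distrib, Finset.sum_sub_distrib,
      ← Finset.mul_sum _ _ (2 : ℝ), h2, h3, Finset.sum_const, Finset.card_univ, nsmul_eq_mul]
    ring
  have h4 : ∑ i, ∑ c, q i c * (∑ k ∈ Finset.range K, (a (t + k) i c : ℝ) +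
        2 * (Fintype.card E * N.tunnelBound) - K * g i c) =
      ∑ i, ∑ c, q i c * ∑ k ∈ Finset.range K, (a (t + k) i c : ℝ) +
        2 * (Fintype.card E * N.tunnelBound) * ∑ i, ∑ c, q i c - K * ∑ i, ∑ c, q i c * g i c := by
    simp only [Finset.mul_sum (Finset.univ : Finset V), Finset.mul_sum (Finset.univ : Finset C),
      ← Finset.sum_add_distrib, ← Finset.sum_sub_distrib]
    exact Finset.sum_congr rfl fun i _ => Finset.sum_congr rfl fun c _ => by ring
  rw [h1] at hsum
  rw [h4]
  linarith

end BPT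

end IsRun

end OverlayNetwork


/-! ### Expected backlogs -/

section Expectation

variable {Ω : Type*} [MeasurableSpace Ω] {P : Measure Ω}

lemma integrable_natCast_of_ae_le [IsFiniteMeasure P] {x : Ω → ℕ} (hx : Measurable x) {B : ℕ}
    (h : ∀ᵐ ω ∂P, x ω ≤ B) : Integrable (fun ω => (x ω : ℝ)) P := by
  refine Integrable.of_bound (measurable_from_nat.comp hx).aestronglyMeasurable (B : ℝ) ?_
  filter_upwards [h] with ω hω
  simpa using hω

lemma lintegral_natCast_eq_ofReal {x : Ω → ℕ} (hx : Integrable (fun ω => (x ω : ℝ)) P) :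
    ∫⁻ ω, (x ω : ℝ≥0∞) ∂P = ENNReal.ofReal (∫ ω, (x ω : ℝ) ∂P) := by
  rw [ofReal_integral_eq_lintegral_ofReal hx (Eventually.of_forall fun ω => Nat.cast_nonneg _)]
  simp

lemma sum_lintegral_natCast {x : ℕ → Ω → ℕ} (hx : ∀ t, Integrable (fun ω => (x t ω : ℝ)) P)
    (T : ℕ) : ∑ t ∈ Finset.range T, ∫⁻ ω, (x t ω : ℝ≥0∞) ∂P =
      ENNReal.ofReal (∑ t ∈ Finset.range T, ∫ ω, (x t ω : ℝ) ∂P) := by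
  rw [ENNReal.ofReal_sum_of_nonneg fun t _ => integral_nonneg fun ω => Nat.cast_nonneg _]
  exact Finset.sum_congr rfl fun t _ => lintegral_natCast_eq_ofReal (hx t)

namespace OverlayNetwork

lemma queueStable_of_le {x : ℕ → Ω → ℕ} (hx : ∀ t, Integrable (fun ω => (x t ω : ℝ)) P) {B : ℝ}
    (h : ∀ T : ℕ, 1 ≤ T → ∑ t ∈ Finset.range T, ∫ ω, (x t ω : ℝ) ∂P ≤ B * T) :
    QueueStable P x := by
  refine lt_of_le_of_lt (b := ENNReal.ofReal B) (limsup_le_of_le (by isBoundedDefault) ?_)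
    ENNReal.ofReal_lt_top
  filter_upwards [eventually_ge_atTop 1] with T hT
  rw [sum_lintegral_natCast hx]
  refine ENNReal.div_le_of_le_mul ?_
  rw [← ENNReal.ofReal_natCast T, ← ENNReal.ofReal_mul' (Nat.cast_nonneg T)]
  exact ENNReal.ofReal_le_ofReal (h T hT)

/-- Translates stability from extended nonnegative integrals to a real bound that can be combined
with the flow inequalities. -/
lemma QueueStable.exists_bound {x : ℕ → Ω → ℕ} (h : QueueStable P x)
    (hx : ∀ t, Integrable (fun ω => (x t ω : ℝ)) P) :
    ∃ B : ℝ, ∀ᶠ T : ℕ in atTop, ∑ t ∈ Finset.range T, ∫ ω, (x t ω : ℝ) ∂P ≤ B * T := by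
  obtain ⟨b, hb, hb'⟩ := exists_between h
  refine ⟨b.toReal, ?_⟩
  filter_upwards [eventually_lt_of_limsup_lt hb, eventually_ge_atTop 1] with T hT hT1
  rw [sum_lintegral_natCast hx] at hT
  have h0 : (T : ℝ≥0∞) ≠ 0 := by simpa using (by omega : T ≠ 0)
  have h1 := (ENNReal.div_le_iff h0 (ENNReal.natCast_ne_top T)).1 hT.le
  rw [← ENNReal.ofReal_toReal hb'.ne, ← ENNReal.ofReal_natCast T,
    ← ENNReal.ofReal_mul ENNReal.toReal_nonneg] at h1
  exact (ENNReal.ofReal_le_ofReal_iff (by positivity)).1 h1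

end OverlayNetwork

/-- Under a product measure, a function of finitely many coordinates is independent of any other
coordinate. -/
lemma integral_mul_eval {ι : Type*} (μ : ι → Measure ℕ) [∀ x, IsProbabilityMeasure (μ x)]
    {S : Finset ι} {x : ι} (hx : x ∉ S) {X : (ι → ℕ) → ℕ} (hX : Measurable X)
    (hXS : ∀ a a', (∀ y ∈ S, a y = a' y) → X a = X a') :
    ∫ a, (X a : ℝ) * a x ∂Measure.infinitePi μ =
      (∫ a, (X a : ℝ) ∂Measure.infinitePi μ) * ∫ n, (n : ℝ) ∂μ x := by
  classical
  have hmean : ∫ a, (a x : ℝ) ∂Measure.infinitePi μ = ∫ n, (n : ℝ) ∂μ x := by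
    have h1 := measurePreserving_eval_infinitePi μ x
    rw [← h1.map_eq,
      integral_map h1.measurable.aemeasurable measurable_from_nat.aestronglyMeasurable]
  have hind : ProbabilityTheory.iIndepFun (fun (x : ι) (a : ι → ℕ) => a x)
      (Measure.infinitePi μ) :=
    ProbabilityTheory.iIndepFun_infinitePi (P := μ) (X := fun _ n => n) fun _ => measurable_id
  have h2 := hind.indepFun_finset S {x} (Finset.disjoint_singleton_right.2 hx)
    fun x => measurable_pi_apply x
  -- Extension by zero exhibits `X` as a measurable function of the coordinates in `S`; the value
  -- `0` is immaterial by `hXS`.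
  set ext : (S → ℕ) → (ι → ℕ) := fun b y => if hy : y ∈ S then b ⟨y, hy⟩ else 0 with hext
  have hextm : Measurable ext := measurable_pi_lambda _ fun y => by
    by_cases hy : y ∈ S
    · simpa [hext, hy] using measurable_pi_apply _
    · simp [hext, hy]
  have hφ : Measurable fun b => ((X (ext b) : ℕ) : ℝ) :=
    measurable_from_nat.comp (hX.comp hextm)
  have hψ : Measurable fun b : ({x} : Finset ι) → ℕ =>
      (b ⟨x, Finset.mem_singleton_self _⟩ : ℝ) :=
    measurable_from_nat.comp (measurable_pi_apply _)
  have hres : ∀ T : Finset ι, Measurable fun (a : ι → ℕ) (y : T) => a y := fun T =>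
    measurable_pi_lambda _ fun y => measurable_pi_apply _
  have h4 := (h2.comp hφ hψ).integral_fun_mul_eq_mul_integral
    (hφ.comp (hres S)).aestronglyMeasurable (hψ.comp (hres {x})).aestronglyMeasurable
  have h5 : ∀ a, X (ext fun y => a y) = X a := fun a => hXS _ _ fun y hy => by simp [hext, hy]
  simp only [Function.comp_def, h5] at h4
  rw [h4, hmean]

/-- A sequence whose time averages are bounded is infinitely often small compared to the time. -/
lemma exists_le_mul_of_avg_bounded {z : ℕ → ℝ} (hz : ∀ t, 0 ≤ z t) {B : ℝ}
    (h : ∀ᶠ T : ℕ in atTop, ∑ t ∈ Finset.range T, z t ≤ B * T) {ε : ℝ} (hε : 0 < ε) :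
    ∃ T : ℕ, 1 ≤ T ∧ z T ≤ ε * T := by
  by_contra hcon
  push Not at hcon
  -- If `z T > ε * T` for all `T ≥ 1`, the partial sums grow quadratically, against the linear
  -- bound.
  have h1 : ∀ T : ℕ, ε * (T * (T - 1) / 2) ≤ ∑ t ∈ Finset.range T, z t := by
    intro T
    induction T with
    | zero => simp
    | succ T ih =>
      rw [Finset.sum_range_succ]
      have : ε * T ≤ z T := by
        rcases Nat.eq_zero_or_pos T with rfl | hT
        · simpa using hz 0
        · exact (hcon T hT).le
      push_cast
      linarith
  obtain ⟨T, hT, hT1, hT2⟩ := (h.and ((eventually_ge_atTop 1).and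
    (eventually_gt_atTop ⌈2 * B / ε + 1⌉₊))).exists
  have hT1' : (1 : ℝ) ≤ T := by exact_mod_cast hT1
  have h2 : 2 * B / ε + 1 < T := (Nat.le_ceil _).trans_lt (by exact_mod_cast hT2)
  have h3 : 2 * B < (T - 1) * ε := (div_lt_iff₀ hε).1 (by linarith)
  have h4 := (h1 T).trans hT
  nlinarith

end Expectation

namespace OverlayNetwork

variable {V W E C : Type*}

/-! ### Measurability of the trajectories -/

section Measurability

variable (N : OverlayNetwork V W E C)

instance : MeasurableSpace (State N) := ⊤

instance : MeasurableSpace (List (Record N)) := ⊤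

instance : MeasurableSpace (Decision E C) := ⊤

instance : DiscreteMeasurableSpace (State N) := ⟨fun _ => trivial⟩

instance : DiscreteMeasurableSpace (List (Record N)) := ⟨fun _ => trivial⟩

instance : DiscreteMeasurableSpace (Decision E C) := ⟨fun _ => trivial⟩

instance [Finite E] [Finite C] : Countable (Decision E C) :=
  Function.Injective.countable (f := fun d : Decision E C => (d.mu, d.inj))
    fun ⟨_, _⟩ ⟨_, _⟩ h => by simpa using h

instance [Finite V] [Finite E] [Finite C] : Countable (State N) :=
  Function.Injective.countable (f := fun s : State N => (s.Q, s.X))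
    fun ⟨_, _⟩ ⟨_, _⟩ h => by simpa using h

instance [Finite V] [Finite E] [Finite C] : Countable (Record N) :=
  Function.Injective.countable
    (f := fun r : Record N => (r.state, r.decision, r.service, r.arrivals))
    fun ⟨_, _, _, _⟩ ⟨_, _, _, _⟩ h => by simpa using h

end Measurability

lemma Scheduling.measurable_serve' {N : OverlayNetwork V W E C} (σ : Scheduling N) (h : History N)
    (s : State N) :
    Measurable fun u : σ.Seed => σ.serve u h s :=
  measurable_pi_lambda _ fun e => measurable_pi_lambda _ fun k => σ.measurable_serve h s e k

lemma Policy.measurable_decide [Fintype E] [Fintype C] [DecidableEq V]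
    {N : OverlayNetwork V W E C} (π : Policy N) (h : History N) (s : State N) :
    Measurable fun w : π.Seed => π.decide w h s := by
  refine measurable_to_countable' fun d => ?_
  have h1 : (fun w : π.Seed => π.decide w h s) ⁻¹' {d} =
      {w | (π.decide w h s).mu = d.mu} ∩ {w | (π.decide w h s).inj = d.inj} := by
    ext w
    obtain ⟨m, j⟩ := d
    simp only [Set.mem_preimage, Set.mem_singleton_iff, Set.mem_inter_iff, Set.mem_ofPred_eq]
    constructor
    · intro h2
      simp [h2]
    · rintro ⟨h2, h3⟩
      cases h4 : π.decide w h s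
      simp_all
  rw [h1]
  exact ((π.measurable_mu h s) (measurableSet_singleton _)).inter
    ((π.measurable_inj h s) (measurableSet_singleton _))

lemma traj_congr [Fintype E] [DecidableEq V] {N : OverlayNetwork V W E C} {σ : Scheduling N}
    {π : Policy N} {a a' : ℕ × V × C → ℕ} (w : π.Seed) (u : σ.Seed) {t : ℕ}
    (h : ∀ x, x.1 < t → a x = a' x) : traj σ π a w u t = traj σ π a' w u t := by
  induction t with
  | zero => rfl
  | succ t ih =>
    simp only [traj, ih fun x hx => h x (Nat.lt_succ_of_lt hx), h (t, _, _) (Nat.lt_succ_self t)]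

section Trajectories

variable [Fintype E] [Fintype C] [DecidableEq V] {N : OverlayNetwork V W E C}
  (σ : Scheduling N) (π : Policy N)

/-- The backlogs at slot `t`. -/
def stateAt (t : ℕ) (ω : (ℕ × V × C → ℕ) × π.Seed × σ.Seed) : State N :=
  (traj σ π ω.1 ω.2.1 ω.2.2 t).2

/-- The decision in slot `t`. -/
def decisionAt (t : ℕ) (ω : (ℕ × V × C → ℕ) × π.Seed × σ.Seed) : Decision E C :=
  π.decide ω.2.1 (traj σ π ω.1 ω.2.1 ω.2.2 t).1 (traj σ π ω.1 ω.2.1 ω.2.2 t).2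

/-- The service of the forwarders in slot `t`. -/
def serviceAt (t : ℕ) (ω : (ℕ × V × C → ℕ) × π.Seed × σ.Seed) : Service N :=
  σ.serve ω.2.2 (traj σ π ω.1 ω.2.1 ω.2.2 t).1 (traj σ π ω.1 ω.2.1 ω.2.2 t).2

variable {σ π}

lemma isRun [DecidableEq W] (hN : N.NonOverlapping) (hσ : σ.WorkConserving)
    (ω : (ℕ × V × C → ℕ) × π.Seed × σ.Seed) :
    IsRun N (fun t => stateAt σ π t ω) (fun t => decisionAt σ π t ω)
      (fun t => serviceAt σ π t ω) (fun t i c => ω.1 (t, i, c)) where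
  start_Q _ _ := rfl
  start_X _ _ _ := rfl
  step _ := rfl
  serve_le t e k c := σ.serve_le _ _ _ e k c
  serve_total t e k := by
    have h := hσ ω.2.2 (traj σ π ω.1 ω.2.1 ω.2.2 t).1 (traj σ π ω.1 ω.2.1 ω.2.2 t).2
      (N.link e (k + 1))
    rw [hN.linkTotal_eq, hN.linkTotal_eq] at h
    exact h

variable [Fintype V]

/-- Policies and schedulings are measurable in the seed only for a fixed past and fixed backlogs. As
these range over a countable set, random ones may be substituted. -/
lemma measurable_slot_of_measurable {Ω X Y : Type*} [MeasurableSpace Ω] [MeasurableSpace X]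
    [MeasurableSpace Y] [Countable X] [DiscreteMeasurableSpace X] {f : Ω → X} (hf : Measurable f)
    {g : X → Ω → Y} (hg : ∀ x, Measurable (g x)) : Measurable fun ω => g (f ω) ω :=
  (measurable_from_prod_countable_right (f := fun p : X × Ω => g p.1 p.2) hg).comp
    (hf.prodMk measurable_id)

lemma measurable_traj (t : ℕ) :
    Measurable fun ω : (ℕ × V × C → ℕ) × π.Seed × σ.Seed => traj σ π ω.1 ω.2.1 ω.2.2 t := by
  induction t with
  | zero => exact measurable_const
  | succ t ih =>
    refine measurable_slot_of_measurable ih (g := fun p ω =>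
      ((⟨p.2, π.decide ω.2.1 p.1 p.2, σ.serve ω.2.2 p.1 p.2, fun i c => ω.1 (t, i, c)⟩ : Record N)
        :: p.1, N.next p.2 (π.decide ω.2.1 p.1 p.2) (σ.serve ω.2.2 p.1 p.2)
          fun i c => ω.1 (t, i, c))) fun p => ?_
    have h1 : Measurable fun ω : (ℕ × V × C → ℕ) × π.Seed × σ.Seed =>
        (π.decide ω.2.1 p.1 p.2, σ.serve ω.2.2 p.1 p.2, fun i c => ω.1 (t, i, c)) :=
      ((π.measurable_decide p.1 p.2).comp (measurable_fst.comp measurable_snd)).prodMk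
        (((σ.measurable_serve' p.1 p.2).comp (measurable_snd.comp measurable_snd)).prodMk
          (measurable_pi_lambda _ fun i => measurable_pi_lambda _ fun c =>
            (measurable_pi_apply (t, i, c)).comp measurable_fst))
    exact (Measurable.of_discrete (f := fun q : Decision E C × Service N × (V → C → ℕ) =>
      (((⟨p.2, q.1, q.2.1, q.2.2⟩ : Record N) :: p.1, N.next p.2 q.1 q.2.1 q.2.2) :
        History N × State N))).comp h1

lemma measurable_stateAt (t : ℕ) : Measurable (stateAt σ π t) :=
  measurable_snd.comp (measurable_traj t)

lemma measurable_serviceAt (t : ℕ) : Measurable (serviceAt σ π t) :=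
  measurable_slot_of_measurable (measurable_traj t) (g := fun p ω => σ.serve ω.2.2 p.1 p.2)
    fun p => (σ.measurable_serve' p.1 p.2).comp (measurable_snd.comp measurable_snd)

lemma measurable_Q (t : ℕ) (i : V) (c : C) : Measurable fun ω => (stateAt σ π t ω).Q i c :=
  (Measurable.of_discrete (f := fun s : State N => s.Q i c)).comp (measurable_stateAt t)

lemma measurable_F (t : ℕ) (e : E) : Measurable fun ω => (stateAt σ π t ω).F e :=
  (Measurable.of_discrete (f := fun s : State N => s.F e)).comp (measurable_stateAt t)

lemma measurable_output (t : ℕ) (e : E) (c : C) :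
    Measurable fun ω => N.output (serviceAt σ π t ω) e c :=
  (Measurable.of_discrete (f := fun φ : Service N => N.output φ e c)).comp (measurable_serviceAt t)

end Trajectories

/-! ### The arrivals -/

section Arrivals

variable [Fintype E] [DecidableEq V] {N : OverlayNetwork V W E C}
  {Amax : ℕ} {A : ArrivalModel N Amax} {σ : Scheduling N} {π : Policy N} {r : V → C → ℝ}

instance : IsProbabilityMeasure (systemLaw A σ π r) := by
  rw [systemLaw]
  infer_instance

lemma measurePreserving_arrival (x : ℕ × V × C) :
    MeasurePreserving (fun ω : (ℕ × V × C → ℕ) × π.Seed × σ.Seed => ω.1 x) (systemLaw A σ π r)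
      (A.law r x.2.1 x.2.2).toMeasure :=
  (measurePreserving_eval_infinitePi
    (fun x : ℕ × V × C => (A.law r x.2.1 x.2.2).toMeasure) x).comp measurePreserving_fst

lemma measurable_arrival (x : ℕ × V × C) :
    Measurable fun ω : (ℕ × V × C → ℕ) × π.Seed × σ.Seed => ω.1 x :=
  (measurable_pi_apply x).comp measurable_fst

lemma integral_arrival (hr : N.Admissible Amax r) (t : ℕ) (i : V) (c : C) :
    ∫ ω, (ω.1 (t, i, c) : ℝ) ∂systemLaw A σ π r = r i c := by
  have h := measurePreserving_arrival (A := A) (σ := σ) (π := π) (r := r) (t, i, c)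
  rw [← A.mean r hr i c, ← h.map_eq,
    integral_map h.measurable.aemeasurable measurable_from_nat.aestronglyMeasurable]

variable [Fintype V] [Fintype C]

lemma ae_arrival_le :
    ∀ᵐ ω ∂systemLaw A σ π r, ∀ t i c, ω.1 (t, i, c) ≤ Amax := by
  rw [ae_all_iff]; intro t
  rw [ae_all_iff]; intro i
  rw [ae_all_iff]; intro c
  have h : ∀ᵐ n ∂(A.law r i c).toMeasure, n ≤ Amax := by
    rw [ae_iff, PMF.toMeasure_apply_eq_zero_iff _ (MeasurableSet.of_discrete)]
    rw [Set.disjoint_left]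
    intro n hn hn'
    exact hn' (A.bounded r i c n hn)
  exact (measurePreserving_arrival (A := A) (σ := σ) (π := π) (r := r)
    (t, i, c)).quasiMeasurePreserving.ae h

/-- The backlogs at slot `t` are independent of the arrivals from slot `t` on. -/
lemma integral_mul_arrival (hr : N.Admissible Amax r) {t τ : ℕ} (h : t ≤ τ) (i : V) (c : C)
    (g : State N → ℕ) {B : ℕ} (hB : ∀ᵐ ω ∂systemLaw A σ π r, g (stateAt σ π t ω) ≤ B) :
    ∫ ω, (g (stateAt σ π t ω) : ℝ) * ω.1 (τ, i, c) ∂systemLaw A σ π r =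
      (∫ ω, (g (stateAt σ π t ω) : ℝ) ∂systemLaw A σ π r) * r i c := by
  have hgm : Measurable fun ω => g (stateAt σ π t ω) :=
    (Measurable.of_discrete (f := g)).comp (measurable_stateAt t)
  have hint : Integrable (fun ω => (g (stateAt σ π t ω) : ℝ) * ω.1 (τ, i, c))
      (systemLaw A σ π r) := by
    have := integrable_natCast_of_ae_le (P := systemLaw A σ π r) (B := B * Amax)
      (hgm.mul (measurable_arrival (σ := σ) (π := π) (τ, i, c))) (by
        filter_upwards [hB, ae_arrival_le] with ω h1 h2
        exact Nat.mul_le_mul h1 (h2 τ i c))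
    simpa using this
  have hint' := integrable_natCast_of_ae_le hgm hB
  rw [systemLaw] at hint hint' ⊢
  -- Integrate over the arrivals first. For fixed seeds the state at slot `t` depends only on the
  -- finitely many arrivals before `t`, so `integral_mul_eval` applies.
  rw [integral_prod_symm _ hint, integral_prod_symm _ hint', ← integral_mul_const]
  refine integral_congr_ae (Eventually.of_forall fun wu => ?_)
  have key := integral_mul_eval (fun x : ℕ × V × C => (A.law r x.2.1 x.2.2).toMeasure)
    (S := Finset.range t ×ˢ Finset.univ) (x := (τ, i, c)) (by simp [h])
    (X := fun a => g (stateAt σ π t (a, wu))) (hgm.comp measurable_prodMk_right)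
    fun a a' haa' => by
      simp only [stateAt]
      rw [traj_congr wu.1 wu.2 fun x hx => haa' x (by simp [hx])]
  rw [A.mean r hr i c] at key
  exact key

end Arrivals

end OverlayNetwork


/-- Telescoping with stride `K` leaves only the first `K` values of `L`; since `T ≥ 1`, they fit
into a multiple of `T`. -/
lemma sum_le_of_drift {L z : ℕ → ℝ} {K : ℕ} {B : ℝ} (hL : ∀ t, 0 ≤ L t)
    (h : ∀ t, L (t + K) + z t ≤ L t + B) (T : ℕ) (hT : 1 ≤ T) :
    ∑ t ∈ Finset.range T, z t ≤ (B + ∑ t ∈ Finset.range K, L t) * T := by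
  have h1 := Finset.sum_le_sum fun t (_ : t ∈ Finset.range T) => h t
  rw [Finset.sum_add_distrib, Finset.sum_add_distrib] at h1
  have h2 : ∑ t ∈ Finset.range T, L t ≤
      ∑ t ∈ Finset.range K, L t + ∑ t ∈ Finset.range T, L (t + K) := by
    have h3 := Finset.sum_range_add L K T
    simp only [add_comm K] at h3
    rw [← h3]
    exact Finset.sum_le_sum_of_subset_of_nonneg
      (Finset.range_subset_range.2 (Nat.le_add_right _ _)) fun t _ _ => hL t
  have h4 : 0 ≤ ∑ t ∈ Finset.range K, L t := Finset.sum_nonneg fun t _ => hL t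
  have h5 : (1 : ℝ) ≤ T := by exact_mod_cast hT
  have h6 := mul_le_mul_of_nonneg_left h5 h4
  simp only [Finset.sum_const, Finset.card_range, nsmul_eq_mul] at h1
  nlinarith

namespace OverlayNetwork

variable {V W E C : Type*}

/-! ### Flows on the overlay graph -/

section Flows

variable [Fintype E] [DecidableEq V] (N : OverlayNetwork V W E C)

/-- Net outflow of a flow on the tunnels from a router. -/
def netOut (p : E → ℝ) (v : V) : ℝ :=
  ∑ e with N.src e = v, p e - ∑ e with N.dst e = v, p e

lemma netOut_add (p p' : E → ℝ) (v : V) : N.netOut (p + p') v = N.netOut p v + N.netOut p' v := by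
  simp only [netOut, Pi.add_apply, Finset.sum_add_distrib]
  ring

lemma netOut_smul (x : ℝ) (p : E → ℝ) (v : V) : N.netOut (x • p) v = x * N.netOut p v := by
  simp only [netOut, Pi.smul_apply, smul_eq_mul, ← Finset.mul_sum]
  ring

lemma netOut_sum {ι : Type*} (s : Finset ι) (p : ι → E → ℝ) (v : V) :
    N.netOut (∑ i ∈ s, p i) v = ∑ i ∈ s, N.netOut (p i) v := by
  classical
  induction s using Finset.induction_on with
  | empty => simp [netOut]
  | insert i s hi ih => rw [Finset.sum_insert hi, Finset.sum_insert hi, netOut_add, ih]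

lemma netOut_single [DecidableEq E] (e : E) (v : V) : N.netOut (Pi.single e 1) v =
    (if v = N.src e then 1 else 0) - (if v = N.dst e then 1 else 0) := by
  simp only [netOut, Pi.single_apply, Finset.sum_ite_eq', Finset.mem_filter, Finset.mem_univ,
    true_and, eq_comm (a := v)]

lemma exists_unit_flow {i j : V}
    (h : Relation.ReflTransGen (fun u v => ∃ e, N.src e = u ∧ N.dst e = v) i j) :
    ∃ p : E → ℝ, (∀ e, 0 ≤ p e) ∧
      ∀ v, N.netOut p v = (if v = i then 1 else 0) - (if v = j then 1 else 0) := by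
  classical
  induction h using Relation.ReflTransGen.head_induction_on with
  | refl => exact ⟨0, fun _ => le_rfl, fun v => by simp [netOut]⟩
  | head h _ ih =>
    obtain ⟨e, rfl, rfl⟩ := h
    obtain ⟨p, hp, hv⟩ := ih
    refine ⟨p + Pi.single e 1, fun e' => add_nonneg (hp e') ?_, fun v => ?_⟩
    · rw [Pi.single_apply]
      split_ifs <;> norm_num
    · rw [netOut_add, hv, netOut_single]
      ring

variable {N}

/-- Superpose unit flows from every router to every destination. Scaling by `1 / (S + 1)`, with `S`
the total flow over all tunnels and sessions, keeps the load of each tunnel below `1 ≤ Rmin`. -/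
lemma DestReachable.exists_interior_flow [Fintype V] [Fintype C] (hR : N.DestReachable) :
    ∃ (f : E → C → ℝ) (η : ℝ), 0 < η ∧ (∀ e c, 0 ≤ f e c) ∧ (∀ e, ∑ c, f e c ≤ N.Rmin e) ∧
      ∀ i c, i ≠ N.dest c → η ≤ N.netOut (fun e => f e c) i := by
  choose p hp0 hp using fun i c => N.exists_unit_flow (hR i c)
  set F : E → C → ℝ := fun e c => ∑ i, p i c e with hF
  have hF0 : ∀ e c, 0 ≤ F e c := fun e c => Finset.sum_nonneg fun i _ => hp0 i c e
  set S := ∑ e, ∑ c, F e c with hS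
  have hS0 : 0 ≤ S := Finset.sum_nonneg fun e _ => Finset.sum_nonneg fun c _ => hF0 e c
  have hη : 0 < 1 / (S + 1) := by positivity
  refine ⟨fun e c => 1 / (S + 1) * F e c, 1 / (S + 1), hη,
    fun e c => mul_nonneg hη.le (hF0 e c), fun e => ?_, fun i c hi => ?_⟩
  · rw [← Finset.mul_sum]
    have h1 : ∑ c, F e c ≤ S := Finset.single_le_sum (f := fun e => ∑ c, F e c)
      (fun e _ => Finset.sum_nonneg fun c _ => hF0 e c) (Finset.mem_univ e)
    have h2 : (1 : ℝ) ≤ N.Rmin e := by exact_mod_cast N.Rmin_pos e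
    refine le_trans ?_ h2
    rw [one_div_mul_eq_div, div_le_one (by positivity)]
    linarith
  · have h1 : (fun e => 1 / (S + 1) * F e c) = (1 / (S + 1)) • ∑ i, p i c := by
      funext e
      simp [hF]
    rw [h1, netOut_smul, netOut_sum]
    simp [hp, hi]

end Flows

/-! ### Packet conservation under an arbitrary policy -/

section PathBounds

variable [Fintype E] [Fintype C] [DecidableEq V] {N : OverlayNetwork V W E C}
  {s : ℕ → State N} {d : ℕ → Decision E C} {φ : ℕ → Service N} {a : ℕ → V → C → ℕ}

namespace IsRun

lemma F_le_mul (hs : IsRun N s d φ a) (hin : ∀ t e, ∑ c, (d t).inj e c ≤ N.Rin e) (e : E)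
    (t : ℕ) : (s t).F e ≤ t * N.Rin e := by
  have h1 := hs.balance e 0 t
  simp only [zero_add] at h1
  have h2 : ∑ i ∈ Finset.range t, ∑ c, (d i).inj e c ≤ t * N.Rin e :=
    (Finset.sum_le_card_nsmul _ _ (N.Rin e) fun i _ => hin i e).trans (by simp)
  have h3 : (s 0).F e = 0 := by simp [State.F, hs.start_X]
  omega

/-- What arrives at a router or enters it from tunnels by slot `t` is still there, in flight, or
has left through other tunnels. -/
lemma conservation_le (hs : IsRun N s d φ a)
    (hdep : ∀ t i c, min ((s t).Q i c) (N.routedOut (d t).mu i c) ≤ N.routedOut (d t).inj i c)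
    {i : V} {c : C} (hi : i ≠ N.dest c) (t : ℕ) :
    ∑ k ∈ Finset.range t, a k i c +
        ∑ e with N.dst e = i, ∑ k ∈ Finset.range t, N.output (φ k) e c ≤
      (s t).Q i c + ∑ e with N.src e = i,
        (∑ k ∈ Finset.range t, N.output (φ k) e c + (s t).F e) := by
  have h1 : ∑ k ∈ Finset.range t, (∑ e with N.dst e = i, N.output (φ k) e c + a k i c) ≤
      (s t).Q i c + ∑ k ∈ Finset.range t, N.routedOut (d k).inj i c := by
    induction t with
    | zero => simp
    | succ t ih =>
      have h2 : (s (t + 1)).Q i c = ((s t).Q i c - N.routedOut (d t).mu i c) +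
          ∑ e with N.dst e = i, N.output (φ t) e c + a t i c := by
        rw [hs.step]
        simp [next, hi]
      have h3 := hdep t i c
      rw [Finset.sum_range_succ, Finset.sum_range_succ]
      omega
  have h2 : ∑ k ∈ Finset.range t, N.routedOut (d k).inj i c ≤ ∑ e with N.src e = i,
      (∑ k ∈ Finset.range t, N.output (φ k) e c + (s t).F e) := by
    simp only [routedOut]
    rw [Finset.sum_comm]
    refine Finset.sum_le_sum fun e _ => ?_
    have h3 := hs.session_balance e c 0 t
    have h4 := (s t).sessionF_le_F e c
    have h5 : (s 0).sessionF e c = 0 := by simp [State.sessionF, hs.start_X]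
    simp only [zero_add] at h3
    omega
  rw [Finset.sum_add_distrib, Finset.sum_comm] at h1
  omega

end IsRun

end PathBounds

/-! ### Expected drift of BP-T, and flows extracted from stable policies -/

section Stability

variable [Fintype V] [Fintype E] [Fintype C] [DecidableEq V]
  {N : OverlayNetwork V W E C} {Amax : ℕ} {A : ArrivalModel N Amax} {σ : Scheduling N}
  {r : V → C → ℝ}

lemma integrable_arrival (π : Policy N) (x : ℕ × V × C) :
    Integrable (fun ω => (ω.1 x : ℝ)) (systemLaw A σ π r) :=
  integrable_natCast_of_ae_le (measurable_arrival x) (B := Amax) (by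
    filter_upwards [ae_arrival_le] with ω hω
    exact hω _ _ _)

variable [DecidableEq W]

lemma ae_Q_le (hN : N.NonOverlapping) (hσ : σ.WorkConserving) (π : Policy N) (t : ℕ) (i : V)
    (c : C) : ∀ᵐ ω ∂systemLaw A σ π r, (stateAt σ π t ω).Q i c ≤ t * N.stepBound Amax := by
  filter_upwards [ae_arrival_le] with ω hω
  exact (isRun hN hσ ω).Q_le_mul hω i c t

lemma integrable_Q (hN : N.NonOverlapping) (hσ : σ.WorkConserving) (π : Policy N) (t : ℕ) (i : V)
    (c : C) : Integrable (fun ω => ((stateAt σ π t ω).Q i c : ℝ)) (systemLaw A σ π r) :=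
  integrable_natCast_of_ae_le (measurable_Q t i c) (ae_Q_le hN hσ π t i c)

lemma integrable_Q_mul_arrival (hN : N.NonOverlapping) (hσ : σ.WorkConserving) (π : Policy N)
    (t : ℕ) (i : V) (c : C) (x : ℕ × V × C) :
    Integrable (fun ω => ((stateAt σ π t ω).Q i c : ℝ) * ω.1 x) (systemLaw A σ π r) := by
  have := integrable_natCast_of_ae_le (P := systemLaw A σ π r)
    (B := t * N.stepBound Amax * Amax)
    ((measurable_Q (σ := σ) (π := π) t i c).mul (measurable_arrival x)) (by
      filter_upwards [ae_Q_le hN hσ π t i c, ae_arrival_le] with ω h1 h2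
      exact Nat.mul_le_mul h1 (h2 _ _ _))
  simpa using this

/-- Expectation of the product of a backlog with the arrivals of a later window, plus drift. -/
lemma integral_Q_mul_window (hN : N.NonOverlapping) (hσ : σ.WorkConserving) (π : Policy N)
    (hr : N.Admissible Amax r) (t K : ℕ) (i : V) (c : C) (x y : ℝ) :
    Integrable (fun ω => ((stateAt σ π t ω).Q i c : ℝ) *
      (∑ k ∈ Finset.range K, (ω.1 (t + k, i, c) : ℝ) + x - y)) (systemLaw A σ π r) ∧
    ∫ ω, ((stateAt σ π t ω).Q i c : ℝ) *
      (∑ k ∈ Finset.range K, (ω.1 (t + k, i, c) : ℝ) + x - y) ∂systemLaw A σ π r =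
      (∫ ω, ((stateAt σ π t ω).Q i c : ℝ) ∂systemLaw A σ π r) * (K * r i c + x - y) := by
  have h1 : (fun ω : (ℕ × V × C → ℕ) × π.Seed × σ.Seed => ((stateAt σ π t ω).Q i c : ℝ) *
      (∑ k ∈ Finset.range K, (ω.1 (t + k, i, c) : ℝ) + x - y)) =
      fun ω => ∑ k ∈ Finset.range K, ((stateAt σ π t ω).Q i c : ℝ) * ω.1 (t + k, i, c) +
        ((stateAt σ π t ω).Q i c : ℝ) * (x - y) := by
    funext ω
    rw [← Finset.mul_sum]
    ring
  have h2 : Integrable (fun ω => ∑ k ∈ Finset.range K,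
      ((stateAt σ π t ω).Q i c : ℝ) * ω.1 (t + k, i, c)) (systemLaw A σ π r) :=
    integrable_finsetSum _ fun k _ => integrable_Q_mul_arrival hN hσ π t i c _
  have h3 : Integrable (fun ω => ((stateAt σ π t ω).Q i c : ℝ) * (x - y)) (systemLaw A σ π r) :=
    (integrable_Q hN hσ π t i c).mul_const _
  rw [h1]
  refine ⟨h2.add h3, ?_⟩
  rw [integral_add h2 h3, integral_mul_const,
    integral_finsetSum _ fun k _ => integrable_Q_mul_arrival hN hσ π t i c _]
  have h4 : ∀ k ∈ Finset.range K,
      ∫ ω, ((stateAt σ π t ω).Q i c : ℝ) * ω.1 (t + k, i, c) ∂systemLaw A σ π r =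
        (∫ ω, ((stateAt σ π t ω).Q i c : ℝ) ∂systemLaw A σ π r) * r i c := fun k _ =>
    integral_mul_arrival hr (Nat.le_add_right t k) i c (fun s => s.Q i c) (ae_Q_le hN hσ π t i c)
  rw [Finset.sum_congr rfl h4, Finset.sum_const, Finset.card_range, nsmul_eq_mul]
  ring

/-- Expected drift of the quadratic Lyapunov function under BP-T, when a flow that respects the
bottlenecks serves the arrival rates with slack. -/
lemma Policy.IsBPT.expected_drift [DecidableEq C] {b : Policy N} (hb : b.IsBPT)
    (hN : N.NonOverlapping) (hσ : σ.WorkConserving) (hr : N.Admissible Amax r) {f : E → C → ℝ}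
    {ε : ℝ} (hε : 0 < ε) (hf : ∀ e c, 0 ≤ f e c) (hfR : ∀ e, ∑ c, f e c ≤ N.Rmin e)
    (hflow : ∀ i c, i ≠ N.dest c → r i c + ε ≤ N.netOut (fun e => f e c) i) :
    ∃ (K : ℕ) (B : ℝ), ∀ t i₀ c₀,
      ∫ ω, ∑ i, ∑ c, ((stateAt σ b (t + K) ω).Q i c : ℝ) ^ 2 ∂systemLaw A σ b r +
        ∫ ω, ((stateAt σ b t ω).Q i₀ c₀ : ℝ) ∂systemLaw A σ b r ≤
      ∫ ω, ∑ i, ∑ c, ((stateAt σ b t ω).Q i c : ℝ) ^ 2 ∂systemLaw A σ b r + B := by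
  have hbd : ∀ ω t, IsBPTDecision (stateAt σ b t ω) (decisionAt σ b t ω) := fun ω t => hb _ _ _
  set P := systemLaw A σ b r with hP
  -- With this `K` the slack `K * ε` exceeds the loss `2 * |E| * tunnelBound` per unit of backlog by
  -- at least `1`.
  obtain ⟨K, hK⟩ := exists_nat_ge ((2 * (Fintype.card E * N.tunnelBound : ℝ) + 1) / ε)
  rw [div_le_iff₀ hε] at hK
  set B : ℝ := Fintype.card V * Fintype.card C * (2 * (K * N.stepBound Amax : ℝ) ^ 2) +
      2 * ∑ e, 2 * (2 * (K * N.stepBound Amax)) * (K * N.Rin e : ℝ) with hB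
  set L : ℕ → ℝ := fun t => ∫ ω, ∑ i, ∑ c, ((stateAt σ b t ω).Q i c : ℝ) ^ 2 ∂P with hL
  have hsq : ∀ t, Integrable (fun ω => ∑ i, ∑ c, ((stateAt σ b t ω).Q i c : ℝ) ^ 2) P := by
    intro t
    refine integrable_finsetSum _ fun i _ => integrable_finsetSum _ fun c _ => ?_
    have := integrable_natCast_of_ae_le (P := P) (B := (t * N.stepBound Amax) ^ 2)
      ((measurable_Q (σ := σ) (π := b) t i c).pow_const 2) (by
        filter_upwards [ae_Q_le hN hσ b t i c] with ω h
        exact Nat.pow_le_pow_left h 2)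
    simpa using this
  refine ⟨K, B, fun t i₀ c₀ => ?_⟩
  change L (t + K) + ∫ ω, ((stateAt σ b t ω).Q i₀ c₀ : ℝ) ∂P ≤ L t + B
  have hwin := fun i c => integral_Q_mul_window (A := A) hN hσ b hr t K i c
    (2 * (Fintype.card E * N.tunnelBound)) (K * (r i c + ε))
  have hwint : Integrable (fun ω => ∑ i, ∑ c, ((stateAt σ b t ω).Q i c : ℝ) *
      (∑ k ∈ Finset.range K, (ω.1 (t + k, i, c) : ℝ) +
        2 * (Fintype.card E * N.tunnelBound) - K * (r i c + ε))) P :=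
    integrable_finsetSum _ fun i _ => integrable_finsetSum _ fun c _ => (hwin i c).1
  have hadd : Integrable (fun ω => ∑ i, ∑ c, ((stateAt σ b t ω).Q i c : ℝ) ^ 2 + B) P :=
    (hsq t).add (integrable_const B)
  have h1 : L (t + K) ≤ ∫ ω, (∑ i, ∑ c, ((stateAt σ b t ω).Q i c : ℝ) ^ 2 + B +
      2 * ∑ i, ∑ c, ((stateAt σ b t ω).Q i c : ℝ) *
      (∑ k ∈ Finset.range K, (ω.1 (t + k, i, c) : ℝ) +
        2 * (Fintype.card E * N.tunnelBound) - K * (r i c + ε))) ∂P := by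
    refine integral_mono_ae (hsq _) (hadd.add (hwint.const_mul 2)) ?_
    filter_upwards [ae_arrival_le] with ω hω
    exact (isRun hN hσ ω).drift (hbd ω) hω hf hfR (g := fun i c => r i c + ε) hflow t K
  rw [integral_add hadd (hwint.const_mul 2),
    integral_add (hsq t) (integrable_const B), integral_const_mul,
    integral_finsetSum _ fun i _ => integrable_finsetSum _ fun c _ => (hwin i c).1] at h1
  have h2 : ∀ i, ∫ ω, ∑ c, ((stateAt σ b t ω).Q i c : ℝ) *
      (∑ k ∈ Finset.range K, (ω.1 (t + k, i, c) : ℝ) +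
        2 * (Fintype.card E * N.tunnelBound) - K * (r i c + ε)) ∂P ≤
      ∑ c, - ∫ ω, ((stateAt σ b t ω).Q i c : ℝ) ∂P := by
    intro i
    rw [integral_finsetSum _ fun c _ => (hwin i c).1]
    refine Finset.sum_le_sum fun c _ => ?_
    rw [(hwin i c).2]
    have h3 : 0 ≤ ∫ ω, ((stateAt σ b t ω).Q i c : ℝ) ∂P :=
      integral_nonneg fun ω => Nat.cast_nonneg _
    have h4 : K * r i c + 2 * (Fintype.card E * N.tunnelBound : ℝ) - K * (r i c + ε) ≤ -1 := by
      linarith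
    linarith [mul_le_mul_of_nonneg_left h4 h3]
  have h5 := Finset.sum_le_sum fun i (_ : i ∈ Finset.univ) => h2 i
  have h6 : ∫ ω, ((stateAt σ b t ω).Q i₀ c₀ : ℝ) ∂P ≤
      ∑ i, ∑ c, ∫ ω, ((stateAt σ b t ω).Q i c : ℝ) ∂P := by
    have h0 : ∀ i c, 0 ≤ ∫ ω, ((stateAt σ b t ω).Q i c : ℝ) ∂P :=
      fun i c => integral_nonneg fun ω => Nat.cast_nonneg _
    exact (Finset.single_le_sum (f := fun c => ∫ ω, ((stateAt σ b t ω).Q i₀ c : ℝ) ∂P)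
      (fun c _ => h0 i₀ c) (Finset.mem_univ c₀)).trans
      (Finset.single_le_sum (f := fun i => ∑ c, ∫ ω, ((stateAt σ b t ω).Q i c : ℝ) ∂P)
        (fun i _ => Finset.sum_nonneg fun c _ => h0 i c) (Finset.mem_univ i₀))
  have h7 : 0 ≤ ∫ ω, ((stateAt σ b t ω).Q i₀ c₀ : ℝ) ∂P :=
    integral_nonneg fun ω => Nat.cast_nonneg _
  simp only [Finset.sum_neg_distrib, integral_const, probReal_univ, one_smul] at h1 h5
  linarith

/-- BP-T stabilizes all arrival rates that a flow respecting the bottlenecks serves with slack. -/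
theorem Policy.IsBPT.stable_of_flow [DecidableEq C] {b : Policy N} (hb : b.IsBPT)
    (hN : N.NonOverlapping) (hσ : σ.WorkConserving) (hr : N.Admissible Amax r) {f : E → C → ℝ}
    {ε : ℝ} (hε : 0 < ε) (hf : ∀ e c, 0 ≤ f e c) (hfR : ∀ e, ∑ c, f e c ≤ N.Rmin e)
    (hflow : ∀ i c, i ≠ N.dest c → r i c + ε ≤ N.netOut (fun e => f e c) i) :
    Stable A σ b r := by
  have hbd : ∀ ω t, IsBPTDecision (stateAt σ b t ω) (decisionAt σ b t ω) := fun ω t => hb _ _ _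
  set P := systemLaw A σ b r with hP
  refine ⟨fun i c => ?_, fun e => ?_⟩
  · obtain ⟨K, B, hdrift⟩ := hb.expected_drift (A := A) hN hσ hr hε hf hfR hflow
    exact queueStable_of_le (x := fun t ω => (stateAt σ b t ω).Q i c)
      (fun t => integrable_Q hN hσ b t i c) (sum_le_of_drift
      (L := fun t => ∫ ω, ∑ i, ∑ c, ((stateAt σ b t ω).Q i c : ℝ) ^ 2 ∂systemLaw A σ b r)
      (fun t => integral_nonneg fun ω => Finset.sum_nonneg fun i _ =>
        Finset.sum_nonneg fun c _ => sq_nonneg _) fun t => hdrift t i c)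
  · have hF : ∀ t ω, (stateAt σ b t ω).F e ≤ N.tunnelBound := fun t ω =>
      (isRun hN hσ ω).F_le_tunnelBound (hbd ω) e t
    have hint : ∀ t, Integrable (fun ω => ((stateAt σ b t ω).F e : ℝ)) P := fun t =>
      integrable_natCast_of_ae_le (measurable_F t e) (Eventually.of_forall (hF t))
    refine queueStable_of_le (x := fun t ω => (stateAt σ b t ω).F e) (B := N.tunnelBound) hint
      fun T _ => ?_
    refine (Finset.sum_le_card_nsmul _ _ (N.tunnelBound : ℝ) fun t _ => ?_).trans
      (by simp [mul_comm])
    refine (integral_mono (hint t) (integrable_const (N.tunnelBound : ℝ))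
      fun ω => Nat.cast_le.2 (hF t ω)).trans (by simp)

/-- If a permissible policy stabilizes the network, then flows that respect the bottlenecks serve
the arrival rates up to an arbitrarily small deficit. -/
theorem Policy.Permissible.exists_flow_of_stable {π : Policy N} (hπ : π.Permissible)
    (hN : N.NonOverlapping) (hσ : σ.WorkConserving) (hr : N.Admissible Amax r)
    (hst : Stable A σ π r) {ε : ℝ} (hε : 0 < ε) :
    ∃ f : E → C → ℝ, (∀ e c, 0 ≤ f e c) ∧ (∀ e, ∑ c, f e c ≤ N.Rmin e) ∧
      ∀ i c, i ≠ N.dest c → r i c - ε ≤ N.netOut (fun e => f e c) i := by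
  set P := systemLaw A σ π r with hP
  have hinj : ∀ ω t e, ∑ c, (decisionAt σ π t ω).inj e c ≤ N.Rin e := fun ω t e =>
    (Finset.sum_le_sum fun c _ => π.inj_le_mu _ _ _ e c).trans (hπ _ _ _ e)
  have hQint : ∀ t i c, Integrable (fun ω => ((stateAt σ π t ω).Q i c : ℝ)) P :=
    fun t i c => integrable_Q hN hσ π t i c
  have hFint : ∀ t e, Integrable (fun ω => ((stateAt σ π t ω).F e : ℝ)) P := fun t e =>
    integrable_natCast_of_ae_le (measurable_F t e)
      (Eventually.of_forall fun ω => (isRun hN hσ ω).F_le_mul (hinj ω) e t)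
  have hOint : ∀ t e c, Integrable (fun ω => (N.output (serviceAt σ π t ω) e c : ℝ)) P :=
    fun t e c => integrable_natCast_of_ae_le (measurable_output t e c)
      (Eventually.of_forall fun ω => (isRun hN hσ ω).output_le e c t)
  set zQ : ℕ → V → C → ℝ := fun t i c => ∫ ω, ((stateAt σ π t ω).Q i c : ℝ) ∂P with hzQ
  set zF : ℕ → E → ℝ := fun t e => ∫ ω, ((stateAt σ π t ω).F e : ℝ) ∂P with hzF
  have hzQ0 : ∀ t i c, 0 ≤ zQ t i c := fun t i c => integral_nonneg fun ω => Nat.cast_nonneg _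
  have hzF0 : ∀ t e, 0 ≤ zF t e := fun t e => integral_nonneg fun ω => Nat.cast_nonneg _
  choose BQ hBQ using fun i c => (hst.1 i c).exists_bound fun t => hQint t i c
  choose BF hBF using fun e => (hst.2 e).exists_bound fun t => hFint t e
  -- Stability bounds only time averages, whereas conservation up to a horizon involves the backlogs
  -- at that very time; hence a `T` at which all expected backlogs together are at most `ε * T`.
  obtain ⟨T, hT1, hT⟩ := exists_le_mul_of_avg_bounded
    (z := fun t => ∑ i, ∑ c, zQ t i c + ∑ e, zF t e) (B := ∑ i, ∑ c, BQ i c + ∑ e, BF e)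
    (fun t => add_nonneg (Finset.sum_nonneg fun i _ => Finset.sum_nonneg fun c _ => hzQ0 t i c)
      (Finset.sum_nonneg fun e _ => hzF0 t e)) (by
      filter_upwards [eventually_all.2 fun i => eventually_all.2 fun c => hBQ i c,
        eventually_all.2 hBF] with T h1 h2
      rw [Finset.sum_add_distrib, Finset.sum_comm, Finset.sum_comm (t := (Finset.univ : Finset E)),
        add_mul, Finset.sum_mul, Finset.sum_mul]
      refine add_le_add (Finset.sum_le_sum fun i _ => ?_) (Finset.sum_le_sum fun e _ => h2 e)
      rw [Finset.sum_comm, Finset.sum_mul]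
      exact Finset.sum_le_sum fun c _ => h1 i c) hε
  have hT0 : (0 : ℝ) < T := by exact_mod_cast hT1
  -- The flow is built from outputs rather than injections: outputs obey the bottleneck exactly, and
  -- at the source router they differ from the injections by at most the tunnel content at `T`.
  set O : E → C → ℝ := fun e c =>
    ∫ ω, (∑ k ∈ Finset.range T, N.output (serviceAt σ π k ω) e c : ℝ) ∂P with hO
  have hOTint : ∀ e c, Integrable
      (fun ω => (∑ k ∈ Finset.range T, N.output (serviceAt σ π k ω) e c : ℝ)) P := fun e c =>
    integrable_finsetSum _ fun k _ => hOint k e c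
  refine ⟨fun e c => (1 / (T : ℝ)) * O e c, fun e c => mul_nonneg (by positivity)
    (integral_nonneg fun ω => Finset.sum_nonneg fun k _ => Nat.cast_nonneg _), fun e => ?_,
    fun i c hi => ?_⟩
  · rw [← Finset.mul_sum, one_div_mul_eq_div, div_le_iff₀ hT0, ← integral_finsetSum _ fun c _ =>
      hOTint e c]
    refine (integral_mono (integrable_finsetSum _ fun c _ => hOTint e c)
      (integrable_const (N.Rmin e * T : ℝ)) fun ω => ?_).trans (by simp)
    have h1 := (isRun hN hσ ω).sum_output_le e (fun t => hinj ω t e) T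
    rw [Finset.sum_comm, mul_comm] at h1
    exact_mod_cast h1
  · have hsum : ∀ e, Integrable (fun ω =>
        (∑ k ∈ Finset.range T, N.output (serviceAt σ π k ω) e c : ℝ) +
          (stateAt σ π T ω).F e) P := fun e => (hOTint e c).add (hFint T e)
    have h1 : ∫ ω, (∑ k ∈ Finset.range T, (ω.1 (k, i, c) : ℝ) + ∑ e with N.dst e = i,
          (∑ k ∈ Finset.range T, (N.output (serviceAt σ π k ω) e c : ℝ))) ∂P ≤
        ∫ ω, (((stateAt σ π T ω).Q i c : ℝ) + ∑ e with N.src e = i,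
          (∑ k ∈ Finset.range T, (N.output (serviceAt σ π k ω) e c : ℝ) +
            (stateAt σ π T ω).F e)) ∂P := by
      refine integral_mono ((integrable_finsetSum _ fun k _ => integrable_arrival π _).add
        (integrable_finsetSum _ fun e _ => hOTint e c)) ((hQint T i c).add
        (integrable_finsetSum _ fun e _ => hsum e)) fun ω => ?_
      have h2 := (isRun hN hσ ω).conservation_le
        (fun t i c => π.departures_le_inj _ _ _ i c) hi T
      dsimp only
      exact_mod_cast h2
    rw [integral_add (integrable_finsetSum _ fun k _ => integrable_arrival π _)
        (integrable_finsetSum _ fun e _ => hOTint e c), integral_add (hQint T i c)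
        (integrable_finsetSum _ fun e _ => hsum e),
      integral_finsetSum _ fun k _ => integrable_arrival π _,
      integral_finsetSum _ fun e _ => hOTint e c,
      integral_finsetSum _ fun e _ => hsum e] at h1
    have h2 : ∀ e, ∫ ω, (∑ k ∈ Finset.range T, (N.output (serviceAt σ π k ω) e c : ℝ) +
        (stateAt σ π T ω).F e) ∂P = O e c + zF T e := fun e =>
      integral_add (hOTint e c) (hFint T e)
    simp only [integral_arrival hr, Finset.sum_const, Finset.card_range, nsmul_eq_mul, h2,
      Finset.sum_add_distrib] at h1
    have h3 : zQ T i c ≤ ∑ i, ∑ c, zQ T i c :=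
      (Finset.single_le_sum (fun c _ => hzQ0 T i c) (Finset.mem_univ c)).trans
        (Finset.single_le_sum (f := fun i => ∑ c, zQ T i c)
          (fun i _ => Finset.sum_nonneg fun c _ => hzQ0 T i c) (Finset.mem_univ i))
    have h4 : ∑ e with N.src e = i, zF T e ≤ ∑ e, zF T e :=
      Finset.sum_le_sum_of_subset_of_nonneg (Finset.filter_subset _ _) fun e _ _ => hzF0 T e
    have h5 : T * (r i c - ε) ≤ N.netOut (fun e => O e c) i := by
      rw [netOut]
      linarith
    have h6 : N.netOut (fun e => 1 / (T : ℝ) * O e c) i = 1 / (T : ℝ) * N.netOut (fun e => O e c) i :=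
      N.netOut_smul _ _ _
    rw [h6, one_div_mul_eq_div, le_div_iff₀ hT0]
    linarith

end Stability

end OverlayNetwork

end

/-! ### Maximal stability of BP-T -/

theorem theorem1 {V W E C : Type*} [Fintype V] [Fintype W] [Fintype E] [Fintype C]
    [DecidableEq V] [DecidableEq W] [DecidableEq C]
    (N : OverlayNetwork V W E C) (hN : N.NonOverlapping) (hR : N.DestReachable)
    (Amax : ℕ) (A : OverlayNetwork.ArrivalModel N Amax)
    (σ : OverlayNetwork.Scheduling N) (hσ : σ.WorkConserving)
    (b : OverlayNetwork.Policy N) (hb : b.IsBPT) :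
    (∀ π : OverlayNetwork.Policy N, π.Permissible →
      OverlayNetwork.policyRegion A σ π ⊆ OverlayNetwork.policyRegion A σ b) ∧
    (∀ r : V → C → ℝ, N.Admissible Amax r →
      (∃ r' ∈ OverlayNetwork.throughputRegion A σ, ∀ i c, i ≠ N.dest c → r i c < r' i c) →
      OverlayNetwork.Stable A σ b r) := by
  constructor
  · intro π hπ
    refine closure_minimal ?_ isClosed_closure
    rintro r ⟨hr, hst⟩
    obtain ⟨g, η, hη, hg, hgR, hgη⟩ := hR.exists_interior_flow
    -- The rates are approached by scaling, since subtracting a constant could make them negative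
    -- and thus inadmissible.
    have hlim : Tendsto (fun δ : ℝ => (1 - δ) • r) (nhdsWithin 0 (Set.Ioi 0)) (nhds r) := by
      have h1 : Continuous fun δ : ℝ => (1 - δ) • r := by fun_prop
      have h2 := h1.tendsto 0
      simp only [sub_zero, one_smul] at h2
      exact h2.mono_left nhdsWithin_le_nhds
    refine mem_closure_of_tendsto hlim ?_
    filter_upwards [Ioo_mem_nhdsGT (one_pos : (0 : ℝ) < 1)] with δ hδ
    obtain ⟨hδ0, hδ1⟩ := hδ
    have hδ1' : 0 ≤ 1 - δ := by linarith
    have hadm : N.Admissible Amax ((1 - δ) • r) := by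
      intro i c
      obtain ⟨h1, h2, h3⟩ := hr i c
      simp only [Pi.smul_apply, smul_eq_mul]
      refine ⟨mul_nonneg hδ1' h1, ?_, fun h => by rw [h3 h, mul_zero]⟩
      nlinarith
    -- In the mixture `(1 - δ) * f + δ * g` the interior flow contributes `δ * η`; half of it pays
    -- for the deficit of `f`, and the other half remains as slack.
    obtain ⟨f, hf, hfR, hfr⟩ := hπ.exists_flow_of_stable hN hσ hr hst
      (ε := δ * η / 2) (by positivity)
    refine ⟨hadm, hb.stable_of_flow hN hσ hadm (f := fun e c => (1 - δ) * f e c + δ * g e c)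
      (ε := δ * η / 2) (by positivity)
      (fun e c => add_nonneg (mul_nonneg hδ1' (hf e c)) (mul_nonneg hδ0.le (hg e c)))
      (fun e => ?_) (fun i c hi => ?_)⟩
    · rw [Finset.sum_add_distrib, ← Finset.mul_sum, ← Finset.mul_sum]
      nlinarith [mul_le_mul_of_nonneg_left (hfR e) hδ1', mul_le_mul_of_nonneg_left (hgR e) hδ0.le]
    · have h1 : N.netOut (fun e => (1 - δ) * f e c + δ * g e c) i =
          (1 - δ) * N.netOut (fun e => f e c) i + δ * N.netOut (fun e => g e c) i := by
        rw [← N.netOut_smul, ← N.netOut_smul, ← N.netOut_add]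
        rfl
      rw [h1]
      have h2 := mul_le_mul_of_nonneg_left (hfr i c hi) hδ1'
      have h3 := mul_le_mul_of_nonneg_left (hgη i c hi) hδ0.le
      have h4 : 0 ≤ δ * (δ * η / 2) := by positivity
      simp only [Pi.smul_apply, smul_eq_mul]
      nlinarith
  · rintro r hr ⟨r', hr', hlt⟩
    -- This open set contains `r'`, a limit of stabilizable rates, hence also a rate vector `x` that
    -- some permissible policy stabilizes.
    have hopen : IsOpen {x : V → C → ℝ | ∀ i c, i ≠ N.dest c → r i c < x i c} := by
      simp only [Set.ofPred_forall]
      refine isOpen_iInter_of_finite fun i => isOpen_iInter_of_finite fun c =>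
        isOpen_iInter_of_finite fun _ => isOpen_lt continuous_const (by fun_prop)
    obtain ⟨x, hx, hxadm, π, hπ, hst⟩ := mem_closure_iff.1 hr' _ hopen hlt
    -- Of the margin `2 * ε`, one `ε` is the deficit of the flow for `x` and the other is the slack
    -- required for `r`.
    have hev : ∀ᶠ ε : ℝ in nhdsWithin 0 (Set.Ioi 0),
        ∀ i c, i ≠ N.dest c → r i c + 2 * ε < x i c := by
      refine eventually_all.2 fun i => eventually_all.2 fun c => eventually_imp_distrib_left.2
        fun hi => ?_
      have h1 : Continuous fun ε : ℝ => r i c + 2 * ε := by fun_prop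
      have h2 := h1.tendsto 0
      simp only [mul_zero, add_zero] at h2
      exact (h2.mono_left nhdsWithin_le_nhds).eventually_lt_const (hx i c hi)
    obtain ⟨ε, hε, hε0⟩ := (hev.and self_mem_nhdsWithin).exists
    obtain ⟨f, hf, hfR, hfr⟩ := hπ.exists_flow_of_stable hN hσ hxadm hst (ε := ε) hε0
    exact hb.stable_of_flow hN hσ hr hε0 hf hfR fun i c hi => by
      linarith [hfr i c hi, hε i c hi]
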